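/- **Setting.** "2-category" and "2-functor" mean strict ones, and $\otimes$ is the Gray tensor product of 2-categories, with interchange isomorphisms $\Sigma_{f,g}\colon (f\otimes 1)(1\otimes g)\cong(1\otimes g)(f\otimes 1)$. A *Gray monoid* $(S,\oplus,e)$ is a monoid for $\otimes$. A *permutative Gray monoid* is a Gray monoid with a 2-natural isomorphism $\beta\colon\oplus\Rightarrow\oplus\circ\tau$ ($\tau$ the symmetry of $\otimes$) such that $\beta_{b,a}\beta_{a,b}=1$ and $\beta_{a,b\oplus c}=(1_b\oplus\beta_{a,c})(\beta_{a,b}\oplus 1_c)$. An *action* of $S$ on a 2-category $X$ is a 2-functor $\mu\colon S\otimes X\to X$, written by juxtaposition (as is $\oplus$), such that $\mu(e,-)=\mathrm{id}_X$ and $\mu(\oplus\otimes 1)=\mu(1\otimes\mu)$. The monoid $S$ has *faithful translations* if each functor $s\oplus-\colon S(x,y)\to S(sx,sy)$ is faithful. A 2-cell is invertible if it is an isomorphism; a 1-cell is invertible if it is an internal equivalence. **The 2-category $S^{-1}X$.** Write $s.(a,x)=(sa,sx)$ for the diagonal action on $S\times X$. Objects of $S^{-1}X$ are pairs $(a,x)\in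 S\times X$. A 1-cell $(a,x)\to(b,y)$ is a triple $(s,\alpha,\varphi)$ with $s\in S$, $\alpha\colon sa\to b$ in $S$ and $\varphi\colon sx\to y$ in $X$. A 2-cell $(s,\alpha,\varphi)\Rightarrow(s',\alpha',\varphi')$ is a class $\langle p,A,F\rangle$ of triples with $p\colon s\to s'$ in $S$ and 2-cells $A\colon\alpha\Rightarrow\alpha'\circ pa$, $F\colon\varphi\Rightarrow\varphi'\circ px$; the triples $(p,A,F)$ and $(q,B,G)$ are identified if there is an invertible 2-cell $\Theta\colon p\cong q$ with $(\alpha'\ast\Theta a)A=B$ and $(\varphi'\ast\Theta x)F=G$. The identity of $(a,x)$ is $(e,1,1)$, and $(t,\gamma,\chi)\circ(s,\alpha,\varphi)=(ts,\gamma\circ t\alpha,\chi\circ t\varphi)$. Vertical composition is pasting of triangles. Whiskering $\langle p,A,F\rangle$ with a later 1-cell $(t,\gamma,\chi)$ gives $\langle tp,\gamma\ast tA,\chi\ast tF\rangle$; whiskering $\langle q,B,G\rangle$ with an earlier 1-cell $(s,\alpha,\varphi)$ gives $qs$ together with the pastings of $B$ with $\Sigma_{q,\alpha}$ and of $G$ with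 $\Sigma_{q,\varphi}$. Let $*$ be the terminal 2-category with its unique action. The projection $\rho\colon S^{-1}X\to S^{-1}*$, induced by $X\to *$, forgets the $X$-components. **Opfibrations.** Let $P\colon K\to L$ be a 2-functor. * A 2-cell $\gamma\colon g\Rightarrow h$ of $K$ is *cartesian* if for all 2-cells $\psi\colon k\Rightarrow h$ and $\phi\colon Pk\Rightarrow Pg$ with $P\psi=P\gamma\circ\phi$ there is a unique $\phi^c\colon k\Rightarrow g$ with $P\phi^c=\phi$ and $\gamma\circ\phi^c=\psi$. * $P$ is a *local fibration* if every 2-cell $\alpha\colon f\Rightarrow Pg$, where $g\colon x\to y$ in $K$ and $f\colon Px\to Py$ in $L$, equals $P\hat\alpha$ for some cartesian 2-cell $\hat\alpha\colon\hat g\Rightarrow g$. * Let $h\colon a\to d$ be a 1-cell of $K$. Given $u\colon a\to b$ in $K$, $t\colon Pd\to Pb$ in $L$ and an invertible 2-cell $\alpha\colon t\circ Ph\cong Pu$, a *lift* of $(u,t,\alpha)$ is a 1-cell $\tilde t\colon d\to b$ with invertible 2-cells $\alpha_1\colon t\cong P\tilde t$ and $\alpha_2\colon\tilde t\circ h\cong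 u$ such that $P\alpha_2\circ(\alpha_1\ast Ph)=\alpha$. * The 1-cell $h$ is *opcartesian* if (1) every such $(u,t,\alpha)$ has a lift; and (2) for all $(u,t,\alpha)$ and $(u',t',\alpha')$ with the same $b$, all lifts $(\tilde t,\alpha_1,\alpha_2)$ and $(\tilde t',\alpha_1',\alpha_2')$ of them, and all 2-cells $\beta\colon t\Rightarrow t'$ and $\sigma\colon u\Rightarrow u'$ with $P\sigma\circ\alpha=\alpha'\circ(\beta\ast Ph)$, there is a unique 2-cell $\tilde\beta\colon\tilde t\Rightarrow\tilde t'$ with $P\tilde\beta\circ\alpha_1=\alpha_1'\circ\beta$ and $\sigma\circ\alpha_2=\alpha_2'\circ(\tilde\beta\ast h)$. * $P$ is an *opfibration* if every 1-cell $f\colon Px\to z$ of $L$ equals $Ph$ for some opcartesian 1-cell $h\colon x\to\hat x$ with $P\hat x=z$, $P$ is a local fibration, and horizontal composites of cartesian 2-cells are cartesian. **Proposition.** Let $S$ be a permutative Gray monoid acting on a 2-category $X$. Assume that $S$ has faithful translations, that all 1-cells and all 2-cells of $S$ are invertible, and that all 2-cells of $X$ are invertible. Then $\rho\colon S^{-1}X\to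 S^{-1}*$ is an opfibration. Moreover, for all objects $s,a,d\in S$ and $x\in X$ and every 1-cell $\alpha\colon sa\to d$ of $S$, the 1-cell $(s,\alpha,1)\colon(a,x)\to(d,sx)$ of $S^{-1}X$ is opcartesian with respect to $\rho$; and every 2-cell of $S^{-1}X$ is cartesian with respect to $\rho$. -/

import Mathlib

open CategoryTheory Bicategory

universe w w₁ w₂ w₃ v v₁ v₂ v₃ u u₁ u₂ u₃

namespace GrayAct

/-! ### Heterogeneous equality of cells in a strict 2-category

Facts saying that the operations of a 2-category respect (heterogeneous) equality and that the
structure cells of a strict 2-category are identities. -/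

section Strictness

variable {B : Type u} [Bicategory.{w, v} B]

theorem comp_heq {a a' b b' c c' : B} (ha : a = a') (hb : b = b') (hc : c = c')
    {f : a ⟶ b} {f' : a' ⟶ b'} (hf : HEq f f') {g : b ⟶ c} {g' : b' ⟶ c'} (hg : HEq g g') :
    HEq (f ≫ g) (f' ≫ g') := by
  subst ha hb hc; cases hf; cases hg; rfl

theorem vcomp_heq {a a' b b' : B} (ha : a = a') (hb : b = b')
    {f g h : a ⟶ b} {f' g' h' : a' ⟶ b'} (hf : HEq f f') (hg : HEq g g') (hh : HEq h h')
    {η : f ⟶ g} {η' : f' ⟶ g'} (h₁ : HEq η η') {θ : g ⟶ h} {θ' : g' ⟶ h'} (h₂ : HEq θ θ') :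
    HEq (η ≫ θ) (η' ≫ θ') := by
  subst ha hb; cases hf; cases hg; cases hh; cases h₁; cases h₂; rfl

theorem id₂_heq {a a' b b' : B} (ha : a = a') (hb : b = b')
    {f : a ⟶ b} {f' : a' ⟶ b'} (hf : HEq f f') : HEq (𝟙 f) (𝟙 f') := by
  subst ha hb; cases hf; rfl

theorem whiskerLeft_heq {a a' b b' c c' : B} (ha : a = a') (hb : b = b') (hc : c = c')
    {f : a ⟶ b} {f' : a' ⟶ b'} (hf : HEq f f') {g h : b ⟶ c} {g' h' : b' ⟶ c'}
    (hg : HEq g g') (hh : HEq h h') {η : g ⟶ h} {η' : g' ⟶ h'} (hη : HEq η η') :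
    HEq (f ◁ η) (f' ◁ η') := by
  subst ha hb hc; cases hf; cases hg; cases hh; cases hη; rfl

theorem whiskerRight_heq {a a' b b' c c' : B} (ha : a = a') (hb : b = b') (hc : c = c')
    {f g : a ⟶ b} {f' g' : a' ⟶ b'} (hf : HEq f f') (hg : HEq g g')
    {η : f ⟶ g} {η' : f' ⟶ g'} (hη : HEq η η') {h : b ⟶ c} {h' : b' ⟶ c'} (hh : HEq h h') :
    HEq (η ▷ h) (η' ▷ h') := by
  subst ha hb hc; cases hf; cases hg; cases hh; cases hη; rfl

theorem eqToHom₂_heq {a b : B} {f g : a ⟶ b} (h : f = g) : HEq (eqToHom h) (𝟙 f) := by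
  subst h; rfl

variable [Strict B]

theorem id_comp_heq {a a' b : B} (h : a = a') (g : a' ⟶ b) : HEq (eqToHom h ≫ g) g := by
  subst h; exact heq_of_eq (Strict.id_comp g)

theorem eqToHom_whiskerLeft_heq {a a' b : B} (h : a = a') {f g : a' ⟶ b} (η : f ⟶ g) :
    HEq (eqToHom h ◁ η) η := by
  subst h
  simp [id_whiskerLeft, Strict.leftUnitor_eqToIso]

theorem comp_assoc_hom_heq {a b c d : B} {k : a ⟶ d} (f : a ⟶ b) (g : b ⟶ c) (h : c ⟶ d)
    (η : k ⟶ (f ≫ g) ≫ h) : HEq (η ≫ (α_ f g h).hom) η := by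
  simp [Strict.associator_eqToIso]

theorem comp_assoc_inv_heq {a b c d : B} {k : a ⟶ d} (f : a ⟶ b) (g : b ⟶ c) (h : c ⟶ d)
    (η : k ⟶ f ≫ g ≫ h) : HEq (η ≫ (α_ f g h).inv) η := by
  simp [Strict.associator_eqToIso]

theorem whiskerRight_eqToHom_heq {a b c : B} {f f' : a ⟶ b} (h : f = f') (g : b ⟶ c)
    {k : a ⟶ c} (η : k ⟶ f ≫ g) : HEq (η ≫ eqToHom h ▷ g) η := by
  subst h; simp

end Strictness

/-! ### The three pastings from which the operations on triangles are made -/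

section Pasting

variable {B : Type u} [Bicategory.{w, v} B]

/-- Vertical pasting of triangles `α ⟶ π ≫ α'` and `α' ⟶ π' ≫ α''`. -/
def pasteV {a a' a'' b : B} {π : a ⟶ a'} {π' : a' ⟶ a''} {α : a ⟶ b} {α' : a' ⟶ b}
    {α'' : a'' ⟶ b} (A : α ⟶ π ≫ α') (A' : α' ⟶ π' ≫ α'') : α ⟶ (π ≫ π') ≫ α'' :=
  A ≫ π ◁ A' ≫ (α_ π π' α'').inv

/-- Pasting of a square `σ` with a triangle `B`. -/
def pasteL {a a' b b' c : B} {φ : a ⟶ b} {φ' : a' ⟶ b'} {κ : a ⟶ a'} {κ' : b ⟶ b'}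
    {γ : b ⟶ c} {γ' : b' ⟶ c} (σ : φ ≫ κ' ⟶ κ ≫ φ') (A : γ ⟶ κ' ≫ γ') :
    φ ≫ γ ⟶ κ ≫ (φ' ≫ γ') :=
  φ ◁ A ≫ (α_ φ κ' γ').inv ≫ σ ▷ γ' ≫ (α_ κ φ' γ').hom

/-- Whiskering of a triangle with a 1-cell out of its tip. -/
def pasteR {a a' b c : B} {π : a ⟶ a'} {α : a ⟶ b} {α' : a' ⟶ b} (A : α ⟶ π ≫ α')
    (γ : b ⟶ c) : α ≫ γ ⟶ π ≫ (α' ≫ γ) :=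
  A ▷ γ ≫ (α_ π α' γ).hom

theorem pasteV_heq {a a' a'' b : B} {π : a ⟶ a'} {π' : a' ⟶ a''} {α : a ⟶ b} {α' : a' ⟶ b}
    {α'' : a'' ⟶ b} {A : α ⟶ π ≫ α'} {A' : α' ⟶ π' ≫ α''}
    {c c' c'' d : B} {ρ : c ⟶ c'} {ρ' : c' ⟶ c''} {β : c ⟶ d} {β' : c' ⟶ d}
    {β'' : c'' ⟶ d} {C : β ⟶ ρ ≫ β'} {C' : β' ⟶ ρ' ≫ β''}
    (h₁ : a = c) (h₂ : a' = c') (h₃ : a'' = c'') (h₄ : b = d) (h₅ : HEq π ρ) (h₆ : HEq π' ρ')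
    (h₇ : HEq α β) (h₈ : HEq α' β') (h₉ : HEq α'' β'') (h : HEq A C) (h' : HEq A' C') :
    HEq (pasteV A A') (pasteV C C') := by
  subst h₁ h₂ h₃ h₄; cases h₅; cases h₆; cases h₇; cases h₈; cases h₉; cases h; cases h'; rfl

theorem pasteL_heq {a a' b b' c : B} {φ : a ⟶ b} {φ' : a' ⟶ b'} {κ : a ⟶ a'} {κ' : b ⟶ b'}
    {γ : b ⟶ c} {γ' : b' ⟶ c} {σ : φ ≫ κ' ⟶ κ ≫ φ'} {A : γ ⟶ κ' ≫ γ'}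
    {x x' y y' z : B} {ψ : x ⟶ y} {ψ' : x' ⟶ y'} {l : x ⟶ x'} {l' : y ⟶ y'}
    {δ : y ⟶ z} {δ' : y' ⟶ z} {τ : ψ ≫ l' ⟶ l ≫ ψ'} {C : δ ⟶ l' ≫ δ'}
    (h₁ : a = x) (h₂ : a' = x') (h₃ : b = y) (h₄ : b' = y') (h₅ : c = z) (h₆ : HEq φ ψ)
    (h₇ : HEq φ' ψ') (h₈ : HEq κ l) (h₉ : HEq κ' l') (h₁₀ : HEq γ δ) (h₁₁ : HEq γ' δ')
    (h : HEq σ τ) (h' : HEq A C) : HEq (pasteL σ A) (pasteL τ C) := by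
  subst h₁ h₂ h₃ h₄ h₅; cases h₆; cases h₇; cases h₈; cases h₉; cases h₁₀; cases h₁₁
  cases h; cases h'; rfl

theorem pasteR_heq {a a' b c : B} {π : a ⟶ a'} {α : a ⟶ b} {α' : a' ⟶ b} {A : α ⟶ π ≫ α'}
    {γ : b ⟶ c} {x x' y z : B} {ρ : x ⟶ x'} {β : x ⟶ y} {β' : x' ⟶ y} {C : β ⟶ ρ ≫ β'}
    {δ : y ⟶ z} (h₁ : a = x) (h₂ : a' = x') (h₃ : b = y) (h₄ : c = z) (h₅ : HEq π ρ)
    (h₆ : HEq α β) (h₇ : HEq α' β') (h : HEq A C) (h' : HEq γ δ) :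
    HEq (pasteR A γ) (pasteR C δ) := by
  subst h₁ h₂ h₃ h₄; cases h₅; cases h₆; cases h₇; cases h; cases h'; rfl

/-- Vertical pasting of squares. -/
def sqV {a a' a'' b b' b'' : B} {φ : a ⟶ b} {φ' : a' ⟶ b'} {φ'' : a'' ⟶ b''} {κ : a ⟶ a'}
    {κ' : b ⟶ b'} {l : a' ⟶ a''} {l' : b' ⟶ b''} (σ : φ ≫ κ' ⟶ κ ≫ φ')
    (τ : φ' ≫ l' ⟶ l ≫ φ'') : φ ≫ (κ' ≫ l') ⟶ (κ ≫ l) ≫ φ'' :=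
  (α_ _ _ _).inv ≫ σ ▷ l' ≫ (α_ _ _ _).hom ≫ κ ◁ τ ≫ (α_ _ _ _).inv

/-- Horizontal pasting of squares. -/
def sqH {a a' b b' c c' : B} {φ : a ⟶ b} {φ' : a' ⟶ b'} {ψ : b ⟶ c} {ψ' : b' ⟶ c'}
    {κ : a ⟶ a'} {l : b ⟶ b'} {m : c ⟶ c'} (σ : φ ≫ l ⟶ κ ≫ φ') (τ : ψ ≫ m ⟶ l ≫ ψ') :
    (φ ≫ ψ) ≫ m ⟶ κ ≫ (φ' ≫ ψ') :=
  (α_ _ _ _).hom ≫ φ ◁ τ ≫ (α_ _ _ _).inv ≫ σ ▷ ψ' ≫ (α_ _ _ _).hom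

theorem pasteV_assoc {a a' a'' a''' b : B} {π : a ⟶ a'} {π' : a' ⟶ a''} {π'' : a'' ⟶ a'''}
    {α : a ⟶ b} {α' : a' ⟶ b} {α'' : a'' ⟶ b} {α''' : a''' ⟶ b} (A : α ⟶ π ≫ α')
    (A' : α' ⟶ π' ≫ α'') (A'' : α'' ⟶ π'' ≫ α''') :
    pasteV (pasteV A A') A'' = pasteV A (pasteV A' A'') ≫ (α_ π π' π'').inv ▷ α''' := by
  simp [pasteV]

theorem pasteL_pasteV {a a' a'' b b' b'' c : B} {φ : a ⟶ b} {φ' : a' ⟶ b'} {φ'' : a'' ⟶ b''}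
    {κ : a ⟶ a'} {κ' : b ⟶ b'} {l : a' ⟶ a''} {l' : b' ⟶ b''}
    {γ : b ⟶ c} {γ' : b' ⟶ c} {γ'' : b'' ⟶ c} (σ : φ ≫ κ' ⟶ κ ≫ φ')
    (τ : φ' ≫ l' ⟶ l ≫ φ'') (A : γ ⟶ κ' ≫ γ') (A' : γ' ⟶ l' ≫ γ'') :
    pasteL (sqV σ τ) (pasteV A A') = pasteV (pasteL σ A) (pasteL τ A') := by
  have h : σ ▷ γ' ≫ (α_ κ φ' γ').hom ≫ κ ◁ φ' ◁ A' =
      (α_ _ _ _).hom ≫ φ ◁ κ' ◁ A' ≫ (α_ _ _ _).inv ≫ σ ▷ (l' ≫ γ'') ≫ (α_ _ _ _).hom := by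
    have := whisker_exchange σ A' =≫ (α_ _ _ _).hom
    simpa using this.symm
  have h' := (α_ φ κ' γ').inv ≫= h
  simp only [Iso.inv_hom_id_assoc] at h'
  simp [pasteL, sqV, pasteV, reassoc_of% h']

theorem pasteR_pasteV {a a' a'' b c : B} {π : a ⟶ a'} {π' : a' ⟶ a''} {α : a ⟶ b}
    {α' : a' ⟶ b} {α'' : a'' ⟶ b} (A : α ⟶ π ≫ α') (A' : α' ⟶ π' ≫ α'') (γ : b ⟶ c) :
    pasteR (pasteV A A') γ = pasteV (pasteR A γ) (pasteR A' γ) := by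
  simp [pasteR, pasteV]

theorem paste_exchange {a₀ a₁ b₀ b₁ c₀ c₁ d : B} {φ : a₀ ⟶ c₀} {φ' : a₁ ⟶ c₁} {π : a₀ ⟶ b₀}
    {π' : a₁ ⟶ b₁} {ψ : b₀ ⟶ c₀} {ψ' : b₁ ⟶ c₁} {κ : a₀ ⟶ a₁} {l : b₀ ⟶ b₁} {m : c₀ ⟶ c₁}
    {γ : c₀ ⟶ d} {γ' : c₁ ⟶ d} (σ : π ≫ l ⟶ κ ≫ π') (τ : ψ ≫ m ⟶ l ≫ ψ')
    (υ : φ ≫ m ⟶ κ ≫ φ') (A : φ ⟶ π ≫ ψ) (A' : φ' ⟶ π' ≫ ψ') (C : γ ⟶ m ≫ γ')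
    (h : A ▷ m ≫ sqH σ τ = υ ≫ κ ◁ A') :
    pasteV (pasteR A γ) (pasteL τ C) ≫ σ ▷ (ψ' ≫ γ') =
      pasteV (pasteL υ C) (pasteR A' γ') := by
  have h' := congr_arg (fun t => φ ◁ C ≫ (α_ φ m γ').inv ≫ t ▷ γ' ≫ (α_ _ _ _).hom ≫
    κ ◁ (α_ _ _ _).hom ≫ (α_ _ _ _).inv) h
  simp [sqH, pasteV, pasteR, pasteL] at h' ⊢
  rw [← h']
  have e := whisker_exchange A C =≫ (α_ _ _ _).hom
  simp only [comp_whiskerLeft, Category.assoc, Iso.inv_hom_id, Category.comp_id,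
    whiskerRight_comp] at e
  rw [← reassoc_of% e]
  simp

theorem pasteL_sqH {a a' b b' c c' d : B} {φ : a ⟶ b} {φ' : a' ⟶ b'} {ψ : b ⟶ c} {ψ' : b' ⟶ c'}
    {κ : a ⟶ a'} {l : b ⟶ b'} {m : c ⟶ c'} {γ : c ⟶ d} {γ' : c' ⟶ d}
    (σ : φ ≫ l ⟶ κ ≫ φ') (τ : ψ ≫ m ⟶ l ≫ ψ') (C : γ ⟶ m ≫ γ') :
    pasteL σ (pasteL τ C) = (α_ _ _ _).inv ≫ pasteL (sqH σ τ) C ≫ κ ◁ (α_ _ _ _).hom := by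
  simp [pasteL, sqH]

theorem pasteR_pasteR {a a' b c d : B} {π : a ⟶ a'} {α : a ⟶ b} {α' : a' ⟶ b} (A : α ⟶ π ≫ α')
    (γ : b ⟶ c) (δ : c ⟶ d) :
    pasteR (pasteR A γ) δ = (α_ _ _ _).hom ≫ pasteR A (γ ≫ δ) ≫ π ◁ (α_ _ _ _).inv := by
  simp [pasteR]

theorem pasteR_pasteL {a a' b b' c d : B} {φ : a ⟶ b} {φ' : a' ⟶ b'} {κ : a ⟶ a'} {κ' : b ⟶ b'}
    {γ : b ⟶ c} {γ' : b' ⟶ c} (σ : φ ≫ κ' ⟶ κ ≫ φ') (A : γ ⟶ κ' ≫ γ') (δ : c ⟶ d) :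
    pasteR (pasteL σ A) δ =
      (α_ _ _ _).hom ≫ pasteL σ (pasteR A δ) ≫ κ ◁ (α_ _ _ _).inv := by
  simp [pasteR, pasteL]

end Pasting

section PastingMore

variable {B : Type u} [Bicategory.{w, v} B]

theorem pasteV_congr {a a' a'' b : B} {π ρ : a ⟶ a'} {π' ρ' : a' ⟶ a''}
    {α : a ⟶ b} {α' : a' ⟶ b} {α'' : a'' ⟶ b} (A : α ⟶ π ≫ α') (A' : α' ⟶ π' ≫ α'')
    (θ : π ⟶ ρ) (ξ : π' ⟶ ρ') :
    pasteV (A ≫ θ ▷ α') (A' ≫ ξ ▷ α'') = pasteV A A' ≫ (θ ▷ π' ≫ ρ ◁ ξ) ▷ α'' := by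
  have h := whisker_exchange θ A'
  simp [pasteV, ← reassoc_of% h]

theorem pasteL_congr {a a' b b' c : B} {φ : a ⟶ b} {φ' : a' ⟶ b'} {κ l : a ⟶ a'}
    {κ' l' : b ⟶ b'} {γ : b ⟶ c} {γ' : b' ⟶ c} {σ : φ ≫ κ' ⟶ κ ≫ φ'} {τ : φ ≫ l' ⟶ l ≫ φ'}
    {θ : κ ⟶ l} {θ' : κ' ⟶ l'} (h : φ ◁ θ' ≫ τ = σ ≫ θ ▷ φ') (A : γ ⟶ κ' ≫ γ') :
    pasteL τ (A ≫ θ' ▷ γ') = pasteL σ A ≫ θ ▷ (φ' ≫ γ') := by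
  have h' := congr_arg (fun t => (α_ φ κ' γ').inv ≫ t ▷ γ') h
  simp at h'
  simp [pasteL, reassoc_of% h']

theorem pasteR_congr {a a' b c : B} {π ρ : a ⟶ a'} {α : a ⟶ b} {α' : a' ⟶ b}
    (A : α ⟶ π ≫ α') (θ : π ⟶ ρ) (γ : b ⟶ c) :
    pasteR (A ≫ θ ▷ α') γ = pasteR A γ ≫ θ ▷ (α' ≫ γ) := by
  simp [pasteR]

variable [Strict B]

theorem eq_eqToHom_of_heq_id {a b : B} {f g : a ⟶ b} (h : f = g) {η : f ⟶ g}
    (hη : HEq η (𝟙 f)) : η = eqToHom h := by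
  subst h; exact eq_of_heq hη

theorem pasteV_id_left {a b c : B} {π : a ⟶ a} (hπ : π = 𝟙 a) {π' : a ⟶ c} {α : a ⟶ b}
    {α' : c ⟶ b} {A : α ⟶ π ≫ α} (hA : HEq A (𝟙 α)) (A' : α ⟶ π' ≫ α') :
    HEq (pasteV A A') A' := by
  subst hπ
  rw [eq_eqToHom_of_heq_id (Strict.id_comp α).symm hA]
  simp [pasteV, Strict.leftUnitor_eqToIso, Strict.associator_eqToIso]

theorem pasteV_id_right {a b c : B} {π : a ⟶ c} {π' : c ⟶ c} (hπ : π' = 𝟙 c) {α : a ⟶ b}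
    {α' : c ⟶ b} (A : α ⟶ π ≫ α') {A' : α' ⟶ π' ≫ α'} (hA : HEq A' (𝟙 α')) :
    HEq (pasteV A A') A := by
  subst hπ
  rw [eq_eqToHom_of_heq_id (Strict.id_comp α').symm hA]
  simp [pasteV, Strict.associator_eqToIso]

theorem pasteL_id {a b c : B} {φ : a ⟶ b} {κ : a ⟶ a} {κ' : b ⟶ b} (hκ : κ = 𝟙 a)
    (hκ' : κ' = 𝟙 b) {γ : b ⟶ c} {σ : φ ≫ κ' ⟶ κ ≫ φ} (hσ : HEq σ (𝟙 φ))
    {A : γ ⟶ κ' ≫ γ} (hA : HEq A (𝟙 γ)) : HEq (pasteL σ A) (𝟙 (φ ≫ γ)) := by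
  subst hκ hκ'
  rw [eq_eqToHom_of_heq_id (Strict.id_comp γ).symm hA,
    eq_eqToHom_of_heq_id ((Strict.comp_id φ).trans (Strict.id_comp φ).symm)
      (hσ.trans (by rw [Strict.comp_id]))]
  simp [pasteL, Strict.associator_eqToIso]
  exact eqToHom₂_heq _

theorem pasteR_id {a b c : B} {π : a ⟶ a} (hπ : π = 𝟙 a) {α : a ⟶ b}
    {A : α ⟶ π ≫ α} (hA : HEq A (𝟙 α)) (γ : b ⟶ c) : HEq (pasteR A γ) (𝟙 (α ≫ γ)) := by
  subst hπ
  rw [eq_eqToHom_of_heq_id (Strict.id_comp α).symm hA]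
  simp [pasteR, Strict.associator_eqToIso]
  exact eqToHom₂_heq _

theorem pasteV_assoc_heq {a a' a'' a''' b : B} {π : a ⟶ a'} {π' : a' ⟶ a''} {π'' : a'' ⟶ a'''}
    {α : a ⟶ b} {α' : a' ⟶ b} {α'' : a'' ⟶ b} {α''' : a''' ⟶ b} (A : α ⟶ π ≫ α')
    (A' : α' ⟶ π' ≫ α'') (A'' : α'' ⟶ π'' ≫ α''') :
    HEq (pasteV (pasteV A A') A'') (pasteV A (pasteV A' A'')) := by
  rw [pasteV_assoc]
  simp [Strict.associator_eqToIso]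

theorem pasteL_sqH_heq {a a' b b' c c' d : B} {φ : a ⟶ b} {φ' : a' ⟶ b'} {ψ : b ⟶ c}
    {ψ' : b' ⟶ c'} {κ : a ⟶ a'} {l : b ⟶ b'} {m : c ⟶ c'} {γ : c ⟶ d} {γ' : c' ⟶ d}
    (σ : φ ≫ l ⟶ κ ≫ φ') (τ : ψ ≫ m ⟶ l ≫ ψ') (C : γ ⟶ m ≫ γ') :
    HEq (pasteL σ (pasteL τ C)) (pasteL (sqH σ τ) C) := by
  rw [pasteL_sqH]
  simp [Strict.associator_eqToIso]

theorem pasteR_pasteR_heq {a a' b c d : B} {π : a ⟶ a'} {α : a ⟶ b} {α' : a' ⟶ b}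
    (A : α ⟶ π ≫ α') (γ : b ⟶ c) (δ : c ⟶ d) :
    HEq (pasteR (pasteR A γ) δ) (pasteR A (γ ≫ δ)) := by
  rw [pasteR_pasteR]
  simp [Strict.associator_eqToIso]

theorem pasteR_pasteL_heq {a a' b b' c d : B} {φ : a ⟶ b} {φ' : a' ⟶ b'} {κ : a ⟶ a'}
    {κ' : b ⟶ b'} {γ : b ⟶ c} {γ' : b' ⟶ c} (σ : φ ≫ κ' ⟶ κ ≫ φ') (A : γ ⟶ κ' ≫ γ')
    (δ : c ⟶ d) : HEq (pasteR (pasteL σ A) δ) (pasteL σ (pasteR A δ)) := by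
  rw [pasteR_pasteL]
  simp [Strict.associator_eqToIso]

theorem sqV_heq_sigma {a a' a'' b b' b'' : B} {φ : a ⟶ b} {φ' : a' ⟶ b'} {φ'' : a'' ⟶ b''}
    {κ : a ⟶ a'} {κ' : b ⟶ b'} {l : a' ⟶ a''} {l' : b' ⟶ b''} (σ : φ ≫ κ' ⟶ κ ≫ φ')
    (τ : φ' ≫ l' ⟶ l ≫ φ'') :
    HEq (sqV σ τ) (σ ▷ l' ≫ (α_ _ _ _).hom ≫ κ ◁ τ) := by
  simp only [sqV, Strict.associator_eqToIso, eqToIso.inv, eqToIso.hom]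
  refine (eqToHom_comp_heq _ _).trans ?_
  simp only [← Category.assoc]
  exact comp_eqToHom_heq _ _

theorem sqH_heq_sigma {a a' b b' c c' : B} {φ : a ⟶ b} {φ' : a' ⟶ b'} {ψ : b ⟶ c} {ψ' : b' ⟶ c'}
    {κ : a ⟶ a'} {l : b ⟶ b'} {m : c ⟶ c'} (σ : φ ≫ l ⟶ κ ≫ φ') (τ : ψ ≫ m ⟶ l ≫ ψ') :
    HEq (sqH σ τ) (φ ◁ τ ≫ (α_ _ _ _).inv ≫ σ ▷ ψ') := by
  simp only [sqH, Strict.associator_eqToIso, eqToIso.inv, eqToIso.hom]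
  refine (eqToHom_comp_heq _ _).trans ?_
  simp only [← Category.assoc]
  exact comp_eqToHom_heq _ _

/-- A square with identity `φ`s does nothing. -/
theorem pasteL_id_side {a a' b b' c : B} (ha : a = b) (ha' : a' = b') {φ : a ⟶ b} {φ' : a' ⟶ b'}
    (hφ : HEq φ (𝟙 b)) (hφ' : HEq φ' (𝟙 b')) {κ : a ⟶ a'} {κ' : b ⟶ b'} (hκ : HEq κ κ')
    {γ : b ⟶ c} {γ' : b' ⟶ c} {σ : φ ≫ κ' ⟶ κ ≫ φ'} (hσ : HEq σ (𝟙 κ')) (A : γ ⟶ κ' ≫ γ') :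
    HEq (pasteL σ A) A := by
  subst ha ha'
  cases hφ; cases hφ'; cases hκ
  rw [eq_eqToHom_of_heq_id ((Strict.id_comp κ).trans (Strict.comp_id κ).symm)
      (hσ.trans (by rw [Strict.id_comp]))]
  simp [pasteL, Strict.associator_eqToIso, Strict.leftUnitor_eqToIso]

theorem pasteR_comp_id {a a' b : B} {π : a ⟶ a'} {α : a ⟶ b} {α' : a' ⟶ b} (A : α ⟶ π ≫ α') :
    HEq (pasteR A (𝟙 b)) A := by
  simp [pasteR, Strict.associator_eqToIso, Strict.rightUnitor_eqToIso]

end PastingMore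

theorem sqH_heq {B : Type u} [Bicategory.{w, v} B] {a a' b b' c c' : B} {φ : a ⟶ b} {φ' : a' ⟶ b'}
    {ψ : b ⟶ c} {ψ' : b' ⟶ c'} {κ : a ⟶ a'} {l : b ⟶ b'} {m : c ⟶ c'}
    {σ : φ ≫ l ⟶ κ ≫ φ'} {τ : ψ ≫ m ⟶ l ≫ ψ'}
    {x x' y y' z z' : B} {f : x ⟶ y} {f' : x' ⟶ y'} {g : y ⟶ z} {g' : y' ⟶ z'} {k : x ⟶ x'}
    {n : y ⟶ y'} {o : z ⟶ z'} {σ' : f ≫ n ⟶ k ≫ f'} {τ' : g ≫ o ⟶ n ≫ g'}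
    (h₁ : a = x) (h₂ : a' = x') (h₃ : b = y) (h₄ : b' = y') (h₅ : c = z) (h₆ : c' = z')
    (h₇ : HEq φ f) (h₈ : HEq φ' f') (h₉ : HEq ψ g) (h₁₀ : HEq ψ' g') (h₁₁ : HEq κ k)
    (h₁₂ : HEq l n) (h₁₃ : HEq m o) (h : HEq σ σ') (h' : HEq τ τ') :
    HEq (sqH σ τ) (sqH σ' τ') := by
  subst h₁ h₂ h₃ h₄ h₅ h₆; cases h₇; cases h₈; cases h₉; cases h₁₀; cases h₁₁; cases h₁₂
  cases h₁₃; cases h; cases h'; rfl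

/-! ### 2-functors out of a Gray tensor product -/

/-- A 2-functor `A ⊗ B ⟶ C` out of the Gray tensor product of two 2-categories, written out on
the generating cells of `A ⊗ B`: it sends `a ⊗ b` to `obj a b`, the generating 1-cells `f ⊗ b` and
`a ⊗ g` to `mapL f b` and `mapR a g`, the generating 2-cells `η ⊗ b` and `a ⊗ θ` to `mapL₂ η b` and
`mapR₂ a θ`, and the interchange 2-cell `Σ_{f,g} : (f ⊗ 1)(1 ⊗ g) ≅ (1 ⊗ g)(f ⊗ 1)` to
`sigma f g`. The equations are the images of the defining relations of `A ⊗ B`.  Equations between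
2-cells whose boundaries agree only by virtue of the other equations are stated with `HEq`. -/
structure GrayFunctor (A : Type u₁) [Bicategory.{w₁, v₁} A] [Strict A]
    (B : Type u₂) [Bicategory.{w₂, v₂} B] [Strict B]
    (C : Type u₃) [Bicategory.{w₃, v₃} C] [Strict C] where
  obj : A → B → C
  mapL {a a' : A} (f : a ⟶ a') (b : B) : obj a b ⟶ obj a' b
  mapR (a : A) {b b' : B} (g : b ⟶ b') : obj a b ⟶ obj a b'
  mapL₂ {a a' : A} {f f' : a ⟶ a'} (η : f ⟶ f') (b : B) : mapL f b ⟶ mapL f' b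
  mapR₂ (a : A) {b b' : B} {g g' : b ⟶ b'} (θ : g ⟶ g') : mapR a g ⟶ mapR a g'
  sigma {a a' : A} (f : a ⟶ a') {b b' : B} (g : b ⟶ b') :
    mapR a g ≫ mapL f b' ≅ mapL f b ≫ mapR a' g
  -- `- ⊗ b` is a 2-functor
  mapL_id (a : A) (b : B) : mapL (𝟙 a) b = 𝟙 (obj a b)
  mapL_comp {a a' a'' : A} (f : a ⟶ a') (f' : a' ⟶ a'') (b : B) :
    mapL (f ≫ f') b = mapL f b ≫ mapL f' b
  mapL₂_id {a a' : A} (f : a ⟶ a') (b : B) : mapL₂ (𝟙 f) b = 𝟙 (mapL f b)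
  mapL₂_comp {a a' : A} {f f' f'' : a ⟶ a'} (η : f ⟶ f') (η' : f' ⟶ f'') (b : B) :
    mapL₂ (η ≫ η') b = mapL₂ η b ≫ mapL₂ η' b
  mapL₂_whiskerLeft {a a' a'' : A} (f : a ⟶ a') {k k' : a' ⟶ a''} (η : k ⟶ k') (b : B) :
    HEq (mapL₂ (f ◁ η) b) (mapL f b ◁ mapL₂ η b)
  mapL₂_whiskerRight {a a' a'' : A} {f f' : a ⟶ a'} (η : f ⟶ f') (k : a' ⟶ a'') (b : B) :
    HEq (mapL₂ (η ▷ k) b) (mapL₂ η b ▷ mapL k b)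
  -- `a ⊗ -` is a 2-functor
  mapR_id (a : A) (b : B) : mapR a (𝟙 b) = 𝟙 (obj a b)
  mapR_comp (a : A) {b b' b'' : B} (g : b ⟶ b') (g' : b' ⟶ b'') :
    mapR a (g ≫ g') = mapR a g ≫ mapR a g'
  mapR₂_id (a : A) {b b' : B} (g : b ⟶ b') : mapR₂ a (𝟙 g) = 𝟙 (mapR a g)
  mapR₂_comp (a : A) {b b' : B} {g g' g'' : b ⟶ b'} (θ : g ⟶ g') (θ' : g' ⟶ g'') :
    mapR₂ a (θ ≫ θ') = mapR₂ a θ ≫ mapR₂ a θ'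
  mapR₂_whiskerLeft (a : A) {b b' b'' : B} (g : b ⟶ b') {k k' : b' ⟶ b''} (θ : k ⟶ k') :
    HEq (mapR₂ a (g ◁ θ)) (mapR a g ◁ mapR₂ a θ)
  mapR₂_whiskerRight (a : A) {b b' b'' : B} {g g' : b ⟶ b'} (θ : g ⟶ g') (k : b' ⟶ b'') :
    HEq (mapR₂ a (θ ▷ k)) (mapR₂ a θ ▷ mapR a k)
  -- `Σ` is natural in both variables and compatible with identities and composition
  sigma_natL {a a' : A} {f f' : a ⟶ a'} (η : f ⟶ f') {b b' : B} (g : b ⟶ b') :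
    mapR a g ◁ mapL₂ η b' ≫ (sigma f' g).hom = (sigma f g).hom ≫ mapL₂ η b ▷ mapR a' g
  sigma_natR {a a' : A} (f : a ⟶ a') {b b' : B} {g g' : b ⟶ b'} (θ : g ⟶ g') :
    mapR₂ a θ ▷ mapL f b' ≫ (sigma f g').hom = (sigma f g).hom ≫ mapL f b ◁ mapR₂ a' θ
  sigma_idL (a : A) {b b' : B} (g : b ⟶ b') : HEq (sigma (𝟙 a) g).hom (𝟙 (mapR a g))
  sigma_idR {a a' : A} (f : a ⟶ a') (b : B) : HEq (sigma f (𝟙 b)).hom (𝟙 (mapL f b))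
  sigma_compL {a a' a'' : A} (f : a ⟶ a') (f' : a' ⟶ a'') {b b' : B} (g : b ⟶ b') :
    HEq (sigma (f ≫ f') g).hom
      ((sigma f g).hom ▷ mapL f' b' ≫ (α_ _ _ _).hom ≫ mapL f b ◁ (sigma f' g).hom)
  sigma_compR {a a' : A} (f : a ⟶ a') {b b' b'' : B} (g : b ⟶ b') (g' : b' ⟶ b'') :
    HEq (sigma f (g ≫ g')).hom
      (mapR a g ◁ (sigma f g').hom ≫ (α_ _ _ _).inv ≫ (sigma f g).hom ▷ mapR a' g')

namespace GrayFunctor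

variable {S : Type u₁} [Bicategory.{w₁, v₁} S] [Strict S]
  {Y : Type u₂} [Bicategory.{w₂, v₂} Y] [Strict Y]

/-- The equality `μ ∘ (m ⊗ 1) = μ ∘ (1 ⊗ μ)` of 2-functors `S ⊗ S ⊗ Y ⟶ Y`, stated on all
generating cells of `S ⊗ S ⊗ Y`. -/
structure IsAssociative (m : GrayFunctor S S S) (μ : GrayFunctor S Y Y) : Prop where
  obj_eq (a b : S) (y : Y) : μ.obj (m.obj a b) y = μ.obj a (μ.obj b y)
  map₁ {a a' : S} (f : a ⟶ a') (b : S) (y : Y) :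
    HEq (μ.mapL (m.mapL f b) y) (μ.mapL f (μ.obj b y))
  map₂ (a : S) {b b' : S} (g : b ⟶ b') (y : Y) :
    HEq (μ.mapL (m.mapR a g) y) (μ.mapR a (μ.mapL g y))
  map₃ (a b : S) {y y' : Y} (h : y ⟶ y') :
    HEq (μ.mapR (m.obj a b) h) (μ.mapR a (μ.mapR b h))
  cell₁ {a a' : S} {f f' : a ⟶ a'} (η : f ⟶ f') (b : S) (y : Y) :
    HEq (μ.mapL₂ (m.mapL₂ η b) y) (μ.mapL₂ η (μ.obj b y))
  cell₂ (a : S) {b b' : S} {g g' : b ⟶ b'} (η : g ⟶ g') (y : Y) :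
    HEq (μ.mapL₂ (m.mapR₂ a η) y) (μ.mapR₂ a (μ.mapL₂ η y))
  cell₃ (a b : S) {y y' : Y} {h h' : y ⟶ y'} (η : h ⟶ h') :
    HEq (μ.mapR₂ (m.obj a b) η) (μ.mapR₂ a (μ.mapR₂ b η))
  sigma₁₂ {a a' b b' : S} (f : a ⟶ a') (g : b ⟶ b') (y : Y) :
    HEq (μ.mapL₂ (m.sigma f g).hom y) (μ.sigma f (μ.mapL g y)).hom
  sigma₁₃ {a a' : S} (f : a ⟶ a') (b : S) {y y' : Y} (h : y ⟶ y') :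
    HEq (μ.sigma (m.mapL f b) h).hom (μ.sigma f (μ.mapR b h)).hom
  sigma₂₃ (a : S) {b b' : S} (g : b ⟶ b') {y y' : Y} (h : y ⟶ y') :
    HEq (μ.sigma (m.mapR a g) h).hom (μ.mapR₂ a (μ.sigma g h).hom)

/-- `μ(e, -)` is the identity 2-functor. -/
structure IsLeftUnital (μ : GrayFunctor S Y Y) (e : S) : Prop where
  obj_eq (y : Y) : μ.obj e y = y
  map {y y' : Y} (g : y ⟶ y') : HEq (μ.mapR e g) g
  cell {y y' : Y} {g g' : y ⟶ y'} (θ : g ⟶ g') : HEq (μ.mapR₂ e θ) θ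

/-- `m(-, e)` is the identity 2-functor. -/
structure IsRightUnital (m : GrayFunctor S S S) (e : S) : Prop where
  obj_eq (a : S) : m.obj a e = a
  map {a a' : S} (f : a ⟶ a') : HEq (m.mapL f e) f
  cell {a a' : S} {f f' : a ⟶ a'} (η : f ⟶ f') : HEq (m.mapL₂ η e) η

end GrayFunctor

/-- A Gray monoid structure on a 2-category `S`: a monoid structure with respect to the Gray
tensor product. -/
structure GrayMonoid (S : Type u) [Bicategory.{w, v} S] [Strict S] where
  tensor : GrayFunctor S S S
  unit : S
  assoc : tensor.IsAssociative tensor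
  unit_left : tensor.IsLeftUnital unit
  unit_right : tensor.IsRightUnital unit

/-- A permutative Gray monoid structure on `S`: a Gray monoid structure with a 2-natural
isomorphism `β : ⊕ ⟶ ⊕ ∘ τ` satisfying the symmetry axiom and the hexagon axiom.
The symmetry `τ` of the Gray tensor product sends `Σ_{f,g}` to the inverse of `Σ_{g,f}`. -/
structure PermutativeGrayMonoid (S : Type u) [Bicategory.{w, v} S] [Strict S] extends
    GrayMonoid S where
  braid (a b : S) : tensor.obj a b ⟶ tensor.obj b a
  braid_natL {a a' : S} (f : a ⟶ a') (b : S) :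
    tensor.mapL f b ≫ braid a' b = braid a b ≫ tensor.mapR b f
  braid_natR (a : S) {b b' : S} (g : b ⟶ b') :
    tensor.mapR a g ≫ braid a b' = braid a b ≫ tensor.mapL g a
  braid_natL₂ {a a' : S} {f f' : a ⟶ a'} (η : f ⟶ f') (b : S) :
    HEq (tensor.mapL₂ η b ▷ braid a' b) (braid a b ◁ tensor.mapR₂ b η)
  braid_natR₂ (a : S) {b b' : S} {g g' : b ⟶ b'} (θ : g ⟶ g') :
    HEq (tensor.mapR₂ a θ ▷ braid a b') (braid a b ◁ tensor.mapL₂ θ a)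
  braid_natSigma {a a' : S} (f : a ⟶ a') {b b' : S} (g : b ⟶ b') :
    HEq ((tensor.sigma f g).hom ▷ braid a' b') (braid a b ◁ (tensor.sigma g f).inv)
  braid_braid (a b : S) : braid a b ≫ braid b a = 𝟙 (tensor.obj a b)
  braid_tensor (a b c : S) :
    HEq (braid a (tensor.obj b c))
      (tensor.mapL (braid a b) c ≫ eqToHom (assoc.obj_eq b a c) ≫ tensor.mapR b (braid a c))

/-- An action of a Gray monoid on a 2-category `X`. -/
structure GrayMonoid.Action {S : Type u₁} [Bicategory.{w₁, v₁} S] [Strict S] (M : GrayMonoid S)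
    (X : Type u₂) [Bicategory.{w₂, v₂} X] [Strict X] where
  act : GrayFunctor S X X
  assoc : M.tensor.IsAssociative act
  unit_left : act.IsLeftUnital M.unit


namespace GrayFunctor

variable {S : Type u₁} [Bicategory.{w₁, v₁} S] [Strict S]
  {Y : Type u₂} [Bicategory.{w₂, v₂} Y] [Strict Y]
  {Z : Type u₃} [Bicategory.{w₃, v₃} Z] [Strict Z] (μ : GrayFunctor S Y Z)

theorem mapR_heq (a : S) {x x' y y' : Y} (hx : x = x') (hy : y = y') {f : x ⟶ y} {f' : x' ⟶ y'}
    (hf : HEq f f') : HEq (μ.mapR a f) (μ.mapR a f') := by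
  subst hx hy; cases hf; rfl

theorem sigma_heq {a a' : S} (q : a ⟶ a') {x x' y y' : Y} (hx : x = x') (hy : y = y')
    {f : x ⟶ y} {f' : x' ⟶ y'} (hf : HEq f f') : HEq (μ.sigma q f).hom (μ.sigma q f').hom := by
  subst hx hy; cases hf; rfl

theorem mapL_obj_heq {a a' : S} (f : a ⟶ a') {y y' : Y} (h : y = y') :
    HEq (μ.mapL f y) (μ.mapL f y') := by
  subst h; rfl

theorem mapR_eqToHom_heq (a : S) {y y' : Y} (h : y = y') :
    HEq (μ.mapR a (eqToHom h)) (𝟙 (μ.obj a y')) := by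
  subst h; exact heq_of_eq (μ.mapR_id a y)

theorem sigma_eqToHom_heq {a a' : S} (q : a ⟶ a') {y y' : Y} (h : y = y') :
    HEq (μ.sigma q (eqToHom h)).hom (𝟙 (μ.mapL q y')) := by
  subst h; exact μ.sigma_idR q y

theorem mapR₂_eqToHom (a : S) {x y : Y} {f g : x ⟶ y} (h : f = g) :
    μ.mapR₂ a (eqToHom h) = eqToHom (by rw [h]) := by
  subst h; exact μ.mapR₂_id a f

theorem mapR₂_whiskerLeft' (a : S) {b b' b'' : Y} (g : b ⟶ b') {k k' : b' ⟶ b''} (θ : k ⟶ k') :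
    μ.mapR₂ a (g ◁ θ) = eqToHom (μ.mapR_comp _ _ _) ≫ μ.mapR a g ◁ μ.mapR₂ a θ ≫
      eqToHom (μ.mapR_comp _ _ _).symm :=
  (conj_eqToHom_iff_heq' _ _ _ _).2 (μ.mapR₂_whiskerLeft a g θ)

theorem mapR₂_whiskerRight' (a : S) {b b' b'' : Y} {g g' : b ⟶ b'} (θ : g ⟶ g') (k : b' ⟶ b'') :
    μ.mapR₂ a (θ ▷ k) = eqToHom (μ.mapR_comp _ _ _) ≫ μ.mapR₂ a θ ▷ μ.mapR a k ≫
      eqToHom (μ.mapR_comp _ _ _).symm :=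
  (conj_eqToHom_iff_heq' _ _ _ _).2 (μ.mapR₂_whiskerRight a θ k)

/-- The image of an invertible 2-cell under `- ⊗ b`. -/
def mapL₂Iso {a a' : S} {f f' : a ⟶ a'} (η : f ≅ f') (b : Y) : μ.mapL f b ≅ μ.mapL f' b where
  hom := μ.mapL₂ η.hom b
  inv := μ.mapL₂ η.inv b
  hom_inv_id := by rw [← μ.mapL₂_comp, η.hom_inv_id, μ.mapL₂_id]
  inv_hom_id := by rw [← μ.mapL₂_comp, η.inv_hom_id, μ.mapL₂_id]

/-- The image of an invertible 2-cell under `a ⊗ -`. -/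
def mapR₂Iso (a : S) {b b' : Y} {g g' : b ⟶ b'} (θ : g ≅ g') : μ.mapR a g ≅ μ.mapR a g' where
  hom := μ.mapR₂ a θ.hom
  inv := μ.mapR₂ a θ.inv
  hom_inv_id := by rw [← μ.mapR₂_comp, θ.hom_inv_id, μ.mapR₂_id]
  inv_hom_id := by rw [← μ.mapR₂_comp, θ.inv_hom_id, μ.mapR₂_id]

/-- The image of a triangle under `a ⊗ -`. -/
def mapTri (a : S) {x x' y : Y} {π : x ⟶ x'} {α : x ⟶ y} {α' : x' ⟶ y} (A : α ⟶ π ≫ α') :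
    μ.mapR a α ⟶ μ.mapR a π ≫ μ.mapR a α' :=
  μ.mapR₂ a A ≫ eqToHom (μ.mapR_comp _ _ _)

/-- The image of a square under `a ⊗ -`. -/
def mapSq (a : S) {x x' y y' : Y} {φ : x ⟶ y} {φ' : x' ⟶ y'} {κ : x ⟶ x'} {κ' : y ⟶ y'}
    (σ : φ ≫ κ' ⟶ κ ≫ φ') : μ.mapR a φ ≫ μ.mapR a κ' ⟶ μ.mapR a κ ≫ μ.mapR a φ' :=
  eqToHom (μ.mapR_comp _ _ _).symm ≫ μ.mapR₂ a σ ≫ eqToHom (μ.mapR_comp _ _ _)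

theorem mapSq_heq (a : S) {x x' y y' : Y} {φ : x ⟶ y} {φ' : x' ⟶ y'} {κ : x ⟶ x'} {κ' : y ⟶ y'}
    (σ : φ ≫ κ' ⟶ κ ≫ φ') : HEq (μ.mapSq a σ) (μ.mapR₂ a σ) :=
  (eqToHom_comp_heq _ _).trans (comp_eqToHom_heq _ _)

theorem mapTri_heq (a : S) {x x' y : Y} {π : x ⟶ x'} {α : x ⟶ y} {α' : x' ⟶ y}
    {A : α ⟶ π ≫ α'} {z z' t : Y} {ρ : z ⟶ z'} {β : z ⟶ t} {β' : z' ⟶ t} {C : β ⟶ ρ ≫ β'}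
    (h₁ : x = z) (h₂ : x' = z') (h₃ : y = t) (h₄ : HEq π ρ) (h₅ : HEq α β) (h₆ : HEq α' β')
    (h : HEq A C) : HEq (μ.mapTri a A) (μ.mapTri a C) := by
  subst h₁ h₂ h₃; cases h₄; cases h₅; cases h₆; cases h; rfl

theorem mapTri_pasteV (s : S) {a a' a'' b : Y} {π : a ⟶ a'} {π' : a' ⟶ a''} {α : a ⟶ b}
    {α' : a' ⟶ b} {α'' : a'' ⟶ b} (A : α ⟶ π ≫ α') (A' : α' ⟶ π' ≫ α'') :
    HEq (μ.mapTri s (pasteV A A')) (pasteV (μ.mapTri s A) (μ.mapTri s A')) := by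
  refine (conj_eqToHom_iff_heq' _ _ rfl (by rw [μ.mapR_comp])).1 ?_
  simp [mapTri, pasteV, μ.mapR₂_comp, mapR₂_whiskerLeft', Strict.associator_eqToIso,
    mapR₂_eqToHom]

theorem mapTri_pasteL (s : S) {a a' b b' c : Y} {φ : a ⟶ b} {φ' : a' ⟶ b'} {κ : a ⟶ a'}
    {κ' : b ⟶ b'} {γ : b ⟶ c} {γ' : b' ⟶ c} (σ : φ ≫ κ' ⟶ κ ≫ φ') (A : γ ⟶ κ' ≫ γ') :
    HEq (μ.mapTri s (pasteL σ A)) (pasteL (μ.mapSq s σ) (μ.mapTri s A)) := by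
  refine (conj_eqToHom_iff_heq' _ _ (by rw [μ.mapR_comp]) (by rw [μ.mapR_comp])).1 ?_
  simp [mapTri, mapSq, pasteL, μ.mapR₂_comp, mapR₂_whiskerLeft', mapR₂_whiskerRight',
    Strict.associator_eqToIso, mapR₂_eqToHom]

theorem mapTri_pasteR (s : S) {a a' b c : Y} {π : a ⟶ a'} {α : a ⟶ b} {α' : a' ⟶ b}
    (A : α ⟶ π ≫ α') (γ : b ⟶ c) :
    HEq (μ.mapTri s (pasteR A γ)) (pasteR (μ.mapTri s A) (μ.mapR s γ)) := by
  refine (conj_eqToHom_iff_heq' _ _ (by rw [μ.mapR_comp]) (by rw [μ.mapR_comp])).1 ?_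
  simp [mapTri, pasteR, μ.mapR₂_comp, mapR₂_whiskerRight', Strict.associator_eqToIso,
    mapR₂_eqToHom]

theorem sigma_triangle {t t' : S} (q : t ⟶ t') {a a' b : Y} {π : a ⟶ a'} {α : a ⟶ b}
    {α' : a' ⟶ b} (A : α ⟶ π ≫ α') :
    μ.mapTri t A ▷ μ.mapL q b ≫ sqH (μ.sigma q π).hom (μ.sigma q α').hom =
      (μ.sigma q α).hom ≫ μ.mapL q a ◁ μ.mapTri t' A := by
  have h := (conj_eqToHom_iff_heq' _ _ (by rw [μ.mapR_comp]) (by rw [μ.mapR_comp])).2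
    ((sqH_heq_sigma (μ.sigma q π).hom (μ.sigma q α').hom).trans (μ.sigma_compR q π α').symm)
  rw [h]
  simp [mapTri, reassoc_of% (μ.sigma_natR q A)]

theorem mapTri_assoc {m : GrayFunctor S S S} {μ : GrayFunctor S Y Y} (hμ : m.IsAssociative μ)
    (s t : S) {a a' b : Y} {π : a ⟶ a'} {α : a ⟶ b} {α' : a' ⟶ b} (A : α ⟶ π ≫ α') :
    HEq (μ.mapTri (m.obj s t) A) (μ.mapTri s (μ.mapTri t A)) := by
  refine (comp_eqToHom_heq _ _).trans ((hμ.cell₃ _ _ _).trans ?_)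
  refine HEq.trans ?_ (comp_eqToHom_heq _ _).symm
  simp [mapTri, μ.mapR₂_comp, mapR₂_eqToHom]

end GrayFunctor

section TranslationCategory

variable {S : Type u₁} [Bicategory.{w₁, v₁} S] [Strict S] {M : GrayMonoid S}
  {Y : Type u₂} [Bicategory.{w₂, v₂} Y] [Strict Y]

/-- For an action of `S` on `Y`, the objects of the 2-category `⟨S, Y⟩`. -/
structure Trans (μ : M.Action Y) where
  pt : Y

namespace Trans

variable {μ : M.Action Y}

/-- A 1-cell `y ⟶ z` of `⟨S, Y⟩`: an object `s` of `S` and a 1-cell `s.y ⟶ z` of `Y`. -/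
structure Hom₁ (y z : Trans μ) where
  s : S
  map : μ.act.obj s y.pt ⟶ z.pt

/-- The identity of `y` is `(e, 1)`, and the composite of `(s, α)` and `(t, γ)` is
`(ts, γ ∘ tα)`; the equality `e.y = y`, respectively `(ts).y = t.(s.y)`, is inserted. -/
instance : CategoryStruct (Trans μ) where
  Hom := Hom₁
  id y := ⟨M.unit, eqToHom (μ.unit_left.obj_eq y.pt)⟩
  comp {y _ _} f g := ⟨M.tensor.obj g.s f.s,
    eqToHom (μ.assoc.obj_eq g.s f.s y.pt) ≫ μ.act.mapR g.s f.map ≫ g.map⟩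

/-- A representative of a 2-cell `(s, α) ⟶ (s', α')`: a 1-cell `p : s ⟶ s'` of `S` and a 2-cell
`α ⟶ α' ∘ (p.y)` of `Y`. -/
structure PreHom₂ {y z : Trans μ} (f g : y ⟶ z) where
  p : f.s ⟶ g.s
  cell : f.map ⟶ μ.act.mapL p y.pt ≫ g.map

/-- `(p, A)` and `(q, B)` represent the same 2-cell if there is an invertible 2-cell
`Θ : p ≅ q` whose action carries `A` to `B`. -/
def PreHom₂.Rel {y z : Trans μ} {f g : y ⟶ z} (P Q : PreHom₂ f g) : Prop :=
  ∃ Θ : P.p ≅ Q.p, P.cell ≫ μ.act.mapL₂ Θ.hom y.pt ▷ g.map = Q.cell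

instance PreHom₂.setoid {y z : Trans μ} (f g : y ⟶ z) : Setoid (PreHom₂ f g) where
  r := PreHom₂.Rel
  iseqv :=
    { refl P := ⟨Iso.refl _, by simp [μ.act.mapL₂_id]⟩
      symm := by
        rintro P Q ⟨Θ, h⟩
        refine ⟨Θ.symm, ?_⟩
        rw [← h, Category.assoc, ← comp_whiskerRight, ← μ.act.mapL₂_comp]
        simp [μ.act.mapL₂_id]
      trans := by
        rintro P Q R ⟨Θ, h⟩ ⟨Ξ, k⟩
        refine ⟨Θ ≪≫ Ξ, ?_⟩
        rw [← k, ← h, Category.assoc, ← comp_whiskerRight, ← μ.act.mapL₂_comp]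
        rfl }

/-- The identity triangle. -/
def PreHom₂.id {y z : Trans μ} (f : y ⟶ z) : PreHom₂ f f :=
  ⟨𝟙 f.s, eqToHom (by rw [μ.act.mapL_id, Strict.id_comp])⟩

/-- Vertical composition: pasting of triangles. -/
def PreHom₂.comp {y z : Trans μ} {f g h : y ⟶ z} (P : PreHom₂ f g) (Q : PreHom₂ g h) :
    PreHom₂ f h :=
  ⟨P.p ≫ Q.p, pasteV P.cell Q.cell ≫ eqToHom (by rw [μ.act.mapL_comp])⟩

/-- Whiskering of `(q, B) : (t, γ) ⟶ (t', γ')` with `(s, α)`: it is given by `qs` and the pasting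
of `B` with `Σ_{q,α}`. -/
def PreHom₂.whiskerLeft {x y z : Trans μ} (f : x ⟶ y) {g h : y ⟶ z} (Q : PreHom₂ g h) :
    PreHom₂ (f ≫ g) (f ≫ h) :=
  ⟨M.tensor.mapL Q.p f.s,
    eqToHom (μ.assoc.obj_eq _ _ _) ◁ pasteL (μ.act.sigma Q.p f.map).hom Q.cell ≫
      eqToHom (eq_of_heq ((id_comp_heq _ _).trans
        (comp_heq (μ.assoc.obj_eq _ _ _).symm (μ.assoc.obj_eq _ _ _).symm rfl
          (μ.assoc.map₁ _ _ _).symm (id_comp_heq _ _).symm)))⟩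

/-- Whiskering of `(p, A) : (s, α) ⟶ (s', α')` with `(t, γ)`: it is given by `tp` and the
whiskering of `tA` with `γ`. -/
def PreHom₂.whiskerRight {x y z : Trans μ} {f g : x ⟶ y} (P : PreHom₂ f g) (h : y ⟶ z) :
    PreHom₂ (f ≫ h) (g ≫ h) :=
  ⟨M.tensor.mapR h.s P.p,
    eqToHom (μ.assoc.obj_eq _ _ _) ◁
      pasteR (μ.act.mapR₂ h.s P.cell ≫ eqToHom (μ.act.mapR_comp _ _ _)) h.map ≫
      eqToHom (eq_of_heq ((id_comp_heq _ _).trans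
        (comp_heq (μ.assoc.obj_eq _ _ _).symm (μ.assoc.obj_eq _ _ _).symm rfl
          (μ.assoc.map₂ _ _ _).symm (id_comp_heq _ _).symm)))⟩

namespace PreHom₂

theorem comp_cell_heq {y z : Trans μ} {f g h : y ⟶ z} (P : PreHom₂ f g) (Q : PreHom₂ g h) :
    HEq (P.comp Q).cell (pasteV P.cell Q.cell) :=
  comp_eqToHom_heq _ _

theorem id_cell_heq {y z : Trans μ} (f : y ⟶ z) : HEq (PreHom₂.id f).cell (𝟙 f.map) :=
  eqToHom₂_heq (by rw [μ.act.mapL_id, Strict.id_comp])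

theorem whiskerLeft_cell_heq {x y z : Trans μ} (f : x ⟶ y) {g h : y ⟶ z} (Q : PreHom₂ g h) :
    HEq (Q.whiskerLeft f).cell (pasteL (μ.act.sigma Q.p f.map).hom Q.cell) :=
  (comp_eqToHom_heq _ _).trans (eqToHom_whiskerLeft_heq _ _)

theorem whiskerRight_cell_heq {x y z : Trans μ} {f g : x ⟶ y} (P : PreHom₂ f g) (h : y ⟶ z) :
    HEq (P.whiskerRight h).cell
      (pasteR (μ.act.mapR₂ h.s P.cell ≫ eqToHom (μ.act.mapR_comp _ _ _)) h.map) :=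
  (comp_eqToHom_heq _ _).trans (eqToHom_whiskerLeft_heq _ _)

theorem comp_rel {y z : Trans μ} {f g h : y ⟶ z} {P P' : PreHom₂ f g} {Q Q' : PreHom₂ g h}
    (hP : P ≈ P') (hQ : Q ≈ Q') : P.comp Q ≈ P'.comp Q' := by
  obtain ⟨Θ, hΘ⟩ := hP
  obtain ⟨Ξ, hΞ⟩ := hQ
  refine ⟨whiskerRightIso Θ Q.p ≪≫ whiskerLeftIso P'.p Ξ, ?_⟩
  have h₁ := (conj_eqToHom_iff_heq' _ _ (μ.act.mapL_comp _ _ _) (μ.act.mapL_comp _ _ _).symm).2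
    (μ.act.mapL₂_whiskerRight Θ.hom Q.p y.pt)
  have h₂ := (conj_eqToHom_iff_heq' _ _ (μ.act.mapL_comp _ _ _) (μ.act.mapL_comp _ _ _).symm).2
    (μ.act.mapL₂_whiskerLeft P'.p Ξ.hom y.pt)
  simp only [Iso.trans_hom, whiskerRightIso_hom, whiskerLeftIso_hom, μ.act.mapL₂_comp, h₁, h₂,
    PreHom₂.comp, ← hΘ, ← hΞ, pasteV_congr]
  simp

end PreHom₂

theorem mk_heq {y z : Trans μ} {f g f' g' : y ⟶ z} (hf : f = f') (hg : g = g')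
    {P : PreHom₂ f g} {P' : PreHom₂ f' g'} (hp : HEq P.p P'.p) (hc : HEq P.cell P'.cell) :
    HEq (Quotient.mk (PreHom₂.setoid f g) P) (Quotient.mk (PreHom₂.setoid f' g') P') := by
  subst hf hg
  cases P; cases P'
  cases hp; cases hc; rfl

instance homCategory (y z : Trans μ) : Category (y ⟶ z) where
  Hom f g := Quotient (PreHom₂.setoid f g)
  id f := ⟦PreHom₂.id f⟧
  comp := Quotient.map₂ PreHom₂.comp fun _ _ h _ _ k => PreHom₂.comp_rel h k
  id_comp := by
    rintro f g ⟨P⟩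
    exact eq_of_heq (mk_heq rfl rfl (heq_of_eq (Strict.id_comp _))
      ((PreHom₂.comp_cell_heq _ _).trans
        (pasteV_id_left (μ.act.mapL_id _ _) (PreHom₂.id_cell_heq _) _)))
  comp_id := by
    rintro f g ⟨P⟩
    exact eq_of_heq (mk_heq rfl rfl (heq_of_eq (Strict.comp_id _))
      ((PreHom₂.comp_cell_heq _ _).trans
        (pasteV_id_right (μ.act.mapL_id _ _) _ (PreHom₂.id_cell_heq _))))
  assoc := by
    rintro f g h k ⟨P⟩ ⟨Q⟩ ⟨R⟩
    refine eq_of_heq (mk_heq rfl rfl (heq_of_eq (Strict.assoc _ _ _))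
      ((PreHom₂.comp_cell_heq _ _).trans (HEq.trans ?_ (PreHom₂.comp_cell_heq _ _).symm)))
    refine (pasteV_heq rfl rfl rfl rfl (heq_of_eq (μ.act.mapL_comp _ _ _)) HEq.rfl HEq.rfl HEq.rfl
      HEq.rfl (PreHom₂.comp_cell_heq _ _) HEq.rfl).trans ((pasteV_assoc_heq _ _ _).trans ?_)
    exact (pasteV_heq rfl rfl rfl rfl HEq.rfl (heq_of_eq (μ.act.mapL_comp _ _ _)) HEq.rfl HEq.rfl
      HEq.rfl HEq.rfl (PreHom₂.comp_cell_heq _ _)).symm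


theorem comp_map_heq {x y z : Trans μ} (f : x ⟶ y) (g : y ⟶ z) :
    HEq (f ≫ g).map (μ.act.mapR g.s f.map ≫ g.map) :=
  id_comp_heq _ _

theorem id_map_heq (y : Trans μ) : HEq (𝟙 y : y ⟶ y).map (𝟙 y.pt) :=
  eqToHom_heq_id_cod _ _ (μ.unit_left.obj_eq y.pt)

theorem hom₁_ext {x y : Trans μ} : ∀ {f g : x ⟶ y}, f.s = g.s → HEq f.map g.map → f = g := by
  intro (f : Hom₁ x y) (g : Hom₁ x y) hs hm
  cases f; cases g
  cases hs; cases hm; rfl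

theorem id_comp₁ {x y : Trans μ} (f : x ⟶ y) : 𝟙 x ≫ f = f :=
  hom₁_ext (M.unit_right.obj_eq _) ((comp_map_heq _ _).trans
    ((comp_heq (congrArg _ (μ.unit_left.obj_eq _)) rfl rfl
      (μ.act.mapR_eqToHom_heq _ (μ.unit_left.obj_eq _)) HEq.rfl).trans
      (heq_of_eq (Strict.id_comp _))))

theorem comp_id₁ {x y : Trans μ} (f : x ⟶ y) : f ≫ 𝟙 y = f :=
  hom₁_ext (M.unit_left.obj_eq _) ((comp_map_heq _ _).trans
    ((comp_heq (μ.unit_left.obj_eq _) (μ.unit_left.obj_eq _) rfl (μ.unit_left.map _)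
      (id_map_heq y)).trans (heq_of_eq (Strict.comp_id _))))

theorem assoc₁ {x y z t : Trans μ} (f : x ⟶ y) (g : y ⟶ z) (h : z ⟶ t) :
    (f ≫ g) ≫ h = f ≫ g ≫ h := by
  refine hom₁_ext (M.assoc.obj_eq _ _ _).symm ?_
  have e : HEq (μ.act.mapR h.s (f ≫ g).map)
      (μ.act.mapR h.s (μ.act.mapR g.s f.map) ≫ μ.act.mapR h.s g.map) :=
    (μ.act.mapR_heq _ (μ.assoc.obj_eq _ _ _) rfl (comp_map_heq f g)).trans
      (heq_of_eq (μ.act.mapR_comp _ _ _))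
  refine (comp_map_heq _ _).trans (HEq.trans ?_ (comp_map_heq _ _).symm)
  refine (comp_heq (congrArg _ (μ.assoc.obj_eq _ _ _)) rfl rfl e HEq.rfl).trans ?_
  refine (heq_of_eq (Strict.assoc _ _ _)).trans ?_
  exact comp_heq (μ.assoc.obj_eq _ _ _).symm (μ.assoc.obj_eq _ _ _).symm rfl
    (μ.assoc.map₃ _ _ _).symm (comp_map_heq _ _).symm

namespace PreHom₂

theorem whiskerLeft_rel {x y z : Trans μ} (f : x ⟶ y) {g h : y ⟶ z} {Q Q' : PreHom₂ g h}
    (hQ : Q ≈ Q') : Q.whiskerLeft f ≈ Q'.whiskerLeft f := by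
  obtain ⟨Ξ, hΞ⟩ := hQ
  refine ⟨M.tensor.mapL₂Iso Ξ f.s, eq_of_heq ?_⟩
  refine HEq.trans ?_ (whiskerLeft_cell_heq f Q').symm
  rw [← hΞ, pasteL_congr (μ.act.sigma_natL Ξ.hom f.map)]
  exact vcomp_heq (μ.assoc.obj_eq _ _ _) rfl (comp_map_heq _ _)
    (comp_heq (μ.assoc.obj_eq _ _ _) (μ.assoc.obj_eq _ _ _) rfl (μ.assoc.map₁ _ _ _)
      (comp_map_heq _ _))
    (comp_heq (μ.assoc.obj_eq _ _ _) (μ.assoc.obj_eq _ _ _) rfl (μ.assoc.map₁ _ _ _)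
      (comp_map_heq _ _))
    (whiskerLeft_cell_heq f Q)
    (whiskerRight_heq (μ.assoc.obj_eq _ _ _) (μ.assoc.obj_eq _ _ _) rfl (μ.assoc.map₁ _ _ _)
      (μ.assoc.map₁ _ _ _) (μ.assoc.cell₁ _ _ _) (comp_map_heq _ _))

theorem whiskerRight_rel {x y z : Trans μ} {f g : x ⟶ y} {P P' : PreHom₂ f g}
    (hP : P ≈ P') (h : y ⟶ z) : P.whiskerRight h ≈ P'.whiskerRight h := by
  obtain ⟨Θ, hΘ⟩ := hP
  refine ⟨M.tensor.mapR₂Iso h.s Θ, eq_of_heq ?_⟩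
  refine HEq.trans ?_ (whiskerRight_cell_heq P' h).symm
  have e : μ.act.mapR₂ h.s P'.cell ≫ eqToHom (μ.act.mapR_comp _ _ _) =
      (μ.act.mapR₂ h.s P.cell ≫ eqToHom (μ.act.mapR_comp _ _ _)) ≫
        μ.act.mapR₂ h.s (μ.act.mapL₂ Θ.hom x.pt) ▷ μ.act.mapR h.s g.map := by
    rw [← hΘ, μ.act.mapR₂_comp, μ.act.mapR₂_whiskerRight']
    simp
  rw [e, pasteR_congr]
  exact vcomp_heq (μ.assoc.obj_eq _ _ _) rfl (comp_map_heq _ _)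
    (comp_heq (μ.assoc.obj_eq _ _ _) (μ.assoc.obj_eq _ _ _) rfl (μ.assoc.map₂ _ _ _)
      (comp_map_heq _ _))
    (comp_heq (μ.assoc.obj_eq _ _ _) (μ.assoc.obj_eq _ _ _) rfl (μ.assoc.map₂ _ _ _)
      (comp_map_heq _ _))
    (whiskerRight_cell_heq P h)
    (whiskerRight_heq (μ.assoc.obj_eq _ _ _) (μ.assoc.obj_eq _ _ _) rfl (μ.assoc.map₂ _ _ _)
      (μ.assoc.map₂ _ _ _) (μ.assoc.cell₂ _ _ _) (comp_map_heq _ _))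

theorem exchange {x y z : Trans μ} {f g : x ⟶ y} {h i : y ⟶ z} (P : PreHom₂ f g)
    (Q : PreHom₂ h i) :
    (P.whiskerRight h).comp (Q.whiskerLeft g) ≈ (Q.whiskerLeft f).comp (P.whiskerRight i) := by
  refine ⟨M.tensor.sigma Q.p P.p, eq_of_heq ?_⟩
  have hx (s t : S) := μ.assoc.obj_eq s t x.pt
  refine HEq.trans ?_ (HEq.trans (heq_of_eq (paste_exchange _ _ _ _ _ Q.cell
    (μ.act.sigma_triangle Q.p P.cell))) ?_)
  · refine vcomp_heq (hx _ _) rfl (comp_map_heq _ _) ?_ ?_ ?_ ?_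
    · refine (comp_heq rfl rfl rfl (heq_of_eq (μ.act.mapL_comp _ _ _)) HEq.rfl).trans ?_
      exact comp_heq (hx _ _) (hx _ _) rfl
        (comp_heq (hx _ _) (hx _ _) (hx _ _) (μ.assoc.map₂ _ _ _) (μ.assoc.map₁ _ _ _))
        (comp_map_heq _ _)
    · refine (comp_heq rfl rfl rfl (heq_of_eq (μ.act.mapL_comp _ _ _)) HEq.rfl).trans ?_
      exact comp_heq (hx _ _) (hx _ _) rfl
        (comp_heq (hx _ _) (hx _ _) (hx _ _) (μ.assoc.map₁ _ _ _) (μ.assoc.map₂ _ _ _))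
        (comp_map_heq _ _)
    · exact (comp_cell_heq _ _).trans (pasteV_heq (hx _ _) (hx _ _) (hx _ _) rfl
        (μ.assoc.map₂ _ _ _) (μ.assoc.map₁ _ _ _) (comp_map_heq _ _) (comp_map_heq _ _)
        (comp_map_heq _ _) (whiskerRight_cell_heq _ _) (whiskerLeft_cell_heq _ _))
    · refine whiskerRight_heq (hx _ _) (hx _ _) rfl ?_ ?_ (μ.assoc.sigma₁₂ _ _ _)
        (comp_map_heq _ _)
      · rw [μ.act.mapL_comp]
        exact comp_heq (hx _ _) (hx _ _) (hx _ _) (μ.assoc.map₂ _ _ _) (μ.assoc.map₁ _ _ _)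
      · rw [μ.act.mapL_comp]
        exact comp_heq (hx _ _) (hx _ _) (hx _ _) (μ.assoc.map₁ _ _ _) (μ.assoc.map₂ _ _ _)
  · exact ((comp_cell_heq _ _).trans (pasteV_heq (hx _ _) (hx _ _) (hx _ _) rfl
        (μ.assoc.map₁ _ _ _) (μ.assoc.map₂ _ _ _) (comp_map_heq _ _) (comp_map_heq _ _)
        (comp_map_heq _ _) (whiskerLeft_cell_heq _ _) (whiskerRight_cell_heq _ _))).symm

end PreHom₂

/-- Whiskering of a 2-cell with a 1-cell on the source side. -/
def whiskerLeft {x y z : Trans μ} (f : x ⟶ y) {g h : y ⟶ z} (η : g ⟶ h) : f ≫ g ⟶ f ≫ h :=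
  Quotient.map (PreHom₂.whiskerLeft f) (fun _ _ h => PreHom₂.whiskerLeft_rel f h) η

/-- Whiskering of a 2-cell with a 1-cell on the target side. -/
def whiskerRight {x y z : Trans μ} {f g : x ⟶ y} (η : f ⟶ g) (h : y ⟶ z) : f ≫ h ⟶ g ≫ h :=
  Quotient.map (fun P => PreHom₂.whiskerRight P h)
    (fun _ _ k => PreHom₂.whiskerRight_rel k h) η

theorem whiskerLeft_id₂ {x y z : Trans μ} (f : x ⟶ y) (g : y ⟶ z) :
    whiskerLeft f (𝟙 g) = 𝟙 (f ≫ g) := by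
  refine eq_of_heq (mk_heq rfl rfl (heq_of_eq (M.tensor.mapL_id _ _))
    ((PreHom₂.whiskerLeft_cell_heq _ _).trans (HEq.trans ?_ (PreHom₂.id_cell_heq _).symm)))
  exact (pasteL_id (A := (PreHom₂.id g).cell) (μ.act.mapL_id _ _) (μ.act.mapL_id _ _)
    (μ.act.sigma_idL _ _) (PreHom₂.id_cell_heq g)).trans
    (id₂_heq (μ.assoc.obj_eq _ _ _) rfl (comp_map_heq _ _)).symm

theorem id₂_whiskerRight {x y z : Trans μ} (f : x ⟶ y) (g : y ⟶ z) :
    whiskerRight (𝟙 f) g = 𝟙 (f ≫ g) := by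
  refine eq_of_heq (mk_heq rfl rfl (heq_of_eq (M.tensor.mapR_id _ _))
    ((PreHom₂.whiskerRight_cell_heq _ _).trans (HEq.trans ?_ (PreHom₂.id_cell_heq _).symm)))
  refine (pasteR_id ?_ ((comp_eqToHom_heq _ _).trans ?_) _).trans
    (id₂_heq (μ.assoc.obj_eq _ _ _) rfl (comp_map_heq _ _)).symm
  · change μ.act.mapR _ (μ.act.mapL (𝟙 f.s) _) = _
    rw [μ.act.mapL_id, μ.act.mapR_id]
  · change HEq (μ.act.mapR₂ _ (eqToHom (show f.map =
      μ.act.mapL (𝟙 f.s) x.pt ≫ f.map by rw [μ.act.mapL_id, Strict.id_comp]))) _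
    rw [μ.act.mapR₂_eqToHom]
    exact eqToHom₂_heq _

theorem whiskerLeft_comp₂ {x y z : Trans μ} (f : x ⟶ y) {g h i : y ⟶ z} (η : g ⟶ h)
    (θ : h ⟶ i) : whiskerLeft f (η ≫ θ) = whiskerLeft f η ≫ whiskerLeft f θ := by
  obtain ⟨P⟩ := η
  obtain ⟨Q⟩ := θ
  refine eq_of_heq (mk_heq rfl rfl (heq_of_eq (M.tensor.mapL_comp _ _ _))
    ((PreHom₂.whiskerLeft_cell_heq _ _).trans (HEq.trans ?_ (PreHom₂.comp_cell_heq _ _).symm)))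
  have hx (s t : S) := μ.assoc.obj_eq s t x.pt
  refine HEq.trans ?_ (pasteV_heq (hx _ _) (hx _ _) (hx _ _) rfl
        (μ.assoc.map₁ _ _ _) (μ.assoc.map₁ _ _ _) (comp_map_heq _ _) (comp_map_heq _ _)
        (comp_map_heq _ _) (PreHom₂.whiskerLeft_cell_heq _ _)
        (PreHom₂.whiskerLeft_cell_heq _ _)).symm
  rw [← pasteL_pasteV]
  exact pasteL_heq rfl rfl rfl rfl rfl HEq.rfl HEq.rfl (heq_of_eq (μ.act.mapL_comp _ _ _))
    (heq_of_eq (μ.act.mapL_comp _ _ _)) HEq.rfl HEq.rfl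
    ((μ.act.sigma_compL _ _ _).trans (sqV_heq_sigma _ _).symm) (PreHom₂.comp_cell_heq _ _)

theorem comp₂_whiskerRight {x y z : Trans μ} {f g h : x ⟶ y} (η : f ⟶ g) (θ : g ⟶ h)
    (i : y ⟶ z) : whiskerRight (η ≫ θ) i = whiskerRight η i ≫ whiskerRight θ i := by
  obtain ⟨P⟩ := η
  obtain ⟨Q⟩ := θ
  refine eq_of_heq (mk_heq rfl rfl (heq_of_eq (M.tensor.mapR_comp _ _ _))
    ((PreHom₂.whiskerRight_cell_heq _ _).trans (HEq.trans ?_ (PreHom₂.comp_cell_heq _ _).symm)))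
  have hx (s t : S) := μ.assoc.obj_eq s t x.pt
  refine HEq.trans ?_ (pasteV_heq (hx _ _) (hx _ _) (hx _ _) rfl
        (μ.assoc.map₂ _ _ _) (μ.assoc.map₂ _ _ _) (comp_map_heq _ _) (comp_map_heq _ _)
        (comp_map_heq _ _) (PreHom₂.whiskerRight_cell_heq _ _)
        (PreHom₂.whiskerRight_cell_heq _ _)).symm
  rw [← pasteR_pasteV]
  have e : μ.act.mapR i.s (μ.act.mapL (P.comp Q).p x.pt) =
      μ.act.mapR i.s (μ.act.mapL P.p x.pt) ≫ μ.act.mapR i.s (μ.act.mapL Q.p x.pt) := by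
    rw [← μ.act.mapR_comp, ← μ.act.mapL_comp]; rfl
  exact pasteR_heq rfl rfl rfl rfl (heq_of_eq e) HEq.rfl HEq.rfl
    ((μ.act.mapTri_heq _ rfl rfl rfl (heq_of_eq (μ.act.mapL_comp _ _ _)) HEq.rfl HEq.rfl
      (PreHom₂.comp_cell_heq P Q)).trans (μ.act.mapTri_pasteV _ _ _)) HEq.rfl

theorem id_whiskerLeft_heq {x y : Trans μ} {f g : x ⟶ y} (η : f ⟶ g) :
    HEq (whiskerLeft (𝟙 x) η) η := by
  obtain ⟨P⟩ := η
  refine mk_heq (id_comp₁ _) (id_comp₁ _) (M.unit_right.map _)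
    ((PreHom₂.whiskerLeft_cell_heq _ _).trans ?_)
  have hx := μ.unit_left.obj_eq x.pt
  exact pasteL_id_side (congrArg _ hx) (congrArg _ hx)
    (μ.act.mapR_eqToHom_heq _ hx) (μ.act.mapR_eqToHom_heq _ hx) (μ.act.mapL_obj_heq _ hx)
    (μ.act.sigma_eqToHom_heq _ hx) _

theorem whiskerRight_id_heq {x y : Trans μ} {f g : x ⟶ y} (η : f ⟶ g) :
    HEq (whiskerRight η (𝟙 y)) η := by
  obtain ⟨P⟩ := η
  refine mk_heq (comp_id₁ _) (comp_id₁ _) (M.unit_left.map _)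
    ((PreHom₂.whiskerRight_cell_heq _ _).trans (HEq.trans ?_ (pasteR_comp_id _)))
  exact pasteR_heq (μ.unit_left.obj_eq _) (μ.unit_left.obj_eq _) (μ.unit_left.obj_eq _) rfl
    (μ.unit_left.map _) (μ.unit_left.map _) (μ.unit_left.map _)
    ((comp_eqToHom_heq _ _).trans (μ.unit_left.cell _)) (id_map_heq y)

theorem comp_whiskerLeft_heq {x y z t : Trans μ} (f : x ⟶ y) (g : y ⟶ z) {h i : z ⟶ t}
    (η : h ⟶ i) : HEq (whiskerLeft (f ≫ g) η) (whiskerLeft f (whiskerLeft g η)) := by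
  obtain ⟨Q⟩ := η
  refine mk_heq (assoc₁ _ _ _) (assoc₁ _ _ _) (M.assoc.map₁ _ _ _).symm
    ((PreHom₂.whiskerLeft_cell_heq _ _).trans
      (HEq.trans ?_ (PreHom₂.whiskerLeft_cell_heq _ _).symm))
  have e : HEq (μ.act.mapR h.s (f ≫ g).map)
      (μ.act.mapR h.s (μ.act.mapR g.s f.map) ≫ μ.act.mapR h.s g.map) :=
    (μ.act.mapR_heq _ (μ.assoc.obj_eq _ _ _) rfl (comp_map_heq f g)).trans
      (heq_of_eq (μ.act.mapR_comp _ _ _))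
  have e' : HEq (μ.act.mapR i.s (f ≫ g).map)
      (μ.act.mapR i.s (μ.act.mapR g.s f.map) ≫ μ.act.mapR i.s g.map) :=
    (μ.act.mapR_heq _ (μ.assoc.obj_eq _ _ _) rfl (comp_map_heq f g)).trans
      (heq_of_eq (μ.act.mapR_comp _ _ _))
  have hx := μ.assoc.obj_eq g.s f.s x.pt
  refine (pasteL_heq (congrArg _ hx) (congrArg _ hx) rfl rfl rfl e e' (μ.act.mapL_obj_heq _ hx)
    HEq.rfl HEq.rfl HEq.rfl ((μ.act.sigma_heq _ hx rfl (comp_map_heq f g)).trans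
      ((μ.act.sigma_compR _ _ _).trans (sqH_heq_sigma _ _).symm)) HEq.rfl).trans ?_
  refine (pasteL_sqH_heq _ _ _).symm.trans ?_
  exact pasteL_heq (μ.assoc.obj_eq _ _ _).symm (μ.assoc.obj_eq _ _ _).symm
    (μ.assoc.obj_eq _ _ _).symm (μ.assoc.obj_eq _ _ _).symm rfl (μ.assoc.map₃ _ _ _).symm
    (μ.assoc.map₃ _ _ _).symm (μ.assoc.map₁ _ _ _).symm (μ.assoc.map₁ _ _ _).symm
    (comp_map_heq _ _).symm (comp_map_heq _ _).symm (μ.assoc.sigma₁₃ _ _ _).symm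
    (PreHom₂.whiskerLeft_cell_heq g Q).symm

theorem whiskerRight_comp_heq {x y z t : Trans μ} {f g : x ⟶ y} (η : f ⟶ g) (h : y ⟶ z)
    (i : z ⟶ t) : HEq (whiskerRight η (h ≫ i)) (whiskerRight (whiskerRight η h) i) := by
  obtain ⟨P⟩ := η
  refine mk_heq (assoc₁ _ _ _).symm (assoc₁ _ _ _).symm (M.assoc.map₃ _ _ _)
    ((PreHom₂.whiskerRight_cell_heq _ _).trans
      (HEq.trans ?_ (PreHom₂.whiskerRight_cell_heq _ _).symm))
  have hx := μ.assoc.obj_eq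
  have e := (μ.act.mapTri_heq i.s (hx _ _ _) (hx _ _ _) rfl (μ.assoc.map₂ _ _ _)
    (comp_map_heq f h) (comp_map_heq g h) (PreHom₂.whiskerRight_cell_heq P h)).trans
    (μ.act.mapTri_pasteR i.s (μ.act.mapTri h.s P.cell) h.map)
  refine HEq.trans ?_ (pasteR_heq (congrArg _ (hx _ _ _)) (congrArg _ (hx _ _ _)) rfl rfl
    (μ.act.mapR_heq i.s (hx _ _ _) (hx _ _ _) (μ.assoc.map₂ _ _ _))
    ((μ.act.mapR_heq i.s (hx _ _ _) rfl (comp_map_heq f h)).trans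
      (heq_of_eq (μ.act.mapR_comp _ _ _)))
    ((μ.act.mapR_heq i.s (hx _ _ _) rfl (comp_map_heq g h)).trans
      (heq_of_eq (μ.act.mapR_comp _ _ _))) e HEq.rfl).symm
  refine HEq.trans ?_ (pasteR_pasteR_heq _ _ _).symm
  exact pasteR_heq (hx _ _ _) (hx _ _ _) (hx _ _ _) rfl (μ.assoc.map₃ _ _ _)
    (μ.assoc.map₃ _ _ _) (μ.assoc.map₃ _ _ _) (GrayFunctor.mapTri_assoc μ.assoc _ _ _)
    (comp_map_heq _ _)

theorem whisker_assoc_heq {x y z t : Trans μ} (f : x ⟶ y) {g h : y ⟶ z} (η : g ⟶ h)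
    (i : z ⟶ t) : HEq (whiskerRight (whiskerLeft f η) i) (whiskerLeft f (whiskerRight η i)) := by
  obtain ⟨Q⟩ := η
  refine mk_heq (assoc₁ _ _ _) (assoc₁ _ _ _) (M.assoc.map₂ _ _ _).symm
    ((PreHom₂.whiskerRight_cell_heq _ _).trans
      (HEq.trans ?_ (PreHom₂.whiskerLeft_cell_heq _ _).symm))
  have hx := μ.assoc.obj_eq
  have e := (μ.act.mapTri_heq i.s (hx _ _ _) (hx _ _ _) rfl (μ.assoc.map₁ _ _ _)
    (comp_map_heq f g) (comp_map_heq f h) (PreHom₂.whiskerLeft_cell_heq f Q)).trans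
    (μ.act.mapTri_pasteL i.s (μ.act.sigma Q.p f.map).hom Q.cell)
  refine (pasteR_heq (congrArg _ (hx _ _ _)) (congrArg _ (hx _ _ _)) rfl rfl
    (μ.act.mapR_heq i.s (hx _ _ _) (hx _ _ _) (μ.assoc.map₁ _ _ _))
    ((μ.act.mapR_heq i.s (hx _ _ _) rfl (comp_map_heq f g)).trans
      (heq_of_eq (μ.act.mapR_comp _ _ _)))
    ((μ.act.mapR_heq i.s (hx _ _ _) rfl (comp_map_heq f h)).trans
      (heq_of_eq (μ.act.mapR_comp _ _ _))) e HEq.rfl).trans ?_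
  refine (pasteR_pasteL_heq _ _ _).trans ?_
  exact pasteL_heq (hx _ _ _).symm (hx _ _ _).symm (hx _ _ _).symm (hx _ _ _).symm rfl
    (μ.assoc.map₃ _ _ _).symm (μ.assoc.map₃ _ _ _).symm (μ.assoc.map₂ _ _ _).symm
    (μ.assoc.map₂ _ _ _).symm (comp_map_heq _ _).symm (comp_map_heq _ _).symm
    ((μ.act.mapSq_heq _ _).trans (μ.assoc.sigma₂₃ _ _ _).symm)
    (PreHom₂.whiskerRight_cell_heq Q i).symm

theorem whiskerLeft_eqToHom₂ {x y z : Trans μ} (f : x ⟶ y) {g h : y ⟶ z} (e : g = h) :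
    whiskerLeft f (eqToHom e) = eqToHom (by rw [e]) := by
  subst e; exact whiskerLeft_id₂ f g

theorem eqToHom₂_whiskerRight {x y z : Trans μ} {f g : x ⟶ y} (e : f = g) (h : y ⟶ z) :
    whiskerRight (eqToHom e) h = eqToHom (by rw [e]) := by
  subst e; exact id₂_whiskerRight f h

/-- The 2-category `⟨S, Y⟩` of an action of `S` on `Y`; its associators and unitors are
identities. -/
instance bicategory : Bicategory (Trans μ) where
  homCategory := homCategory
  whiskerLeft := whiskerLeft
  whiskerRight := whiskerRight
  associator f g h := eqToIso (assoc₁ f g h)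
  leftUnitor f := eqToIso (id_comp₁ f)
  rightUnitor f := eqToIso (comp_id₁ f)
  whiskerLeft_id := whiskerLeft_id₂
  whiskerLeft_comp f _ _ _ := whiskerLeft_comp₂ f
  id_whiskerLeft {_ _ f g} η :=
    (conj_eqToHom_iff_heq' _ _ (id_comp₁ f) (id_comp₁ g).symm).2 (id_whiskerLeft_heq η)
  comp_whiskerLeft f g h h' η :=
    (conj_eqToHom_iff_heq' _ _ (assoc₁ f g h) (assoc₁ f g h').symm).2 (comp_whiskerLeft_heq f g η)
  id_whiskerRight := id₂_whiskerRight
  comp_whiskerRight := comp₂_whiskerRight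
  whiskerRight_id {_ _ f g} η :=
    (conj_eqToHom_iff_heq' _ _ (comp_id₁ f) (comp_id₁ g).symm).2 (whiskerRight_id_heq η)
  whiskerRight_comp {_ _ _ _ f f'} η g h :=
    (conj_eqToHom_iff_heq' _ _ (assoc₁ f g h).symm (assoc₁ f' g h)).2 (whiskerRight_comp_heq η g h)
  whisker_assoc f g g' η h :=
    (conj_eqToHom_iff_heq' _ _ (assoc₁ f g h) (assoc₁ f g' h).symm).2 (whisker_assoc_heq f η h)
  whisker_exchange := by
    rintro x y z f g h i ⟨P⟩ ⟨Q⟩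
    exact (Quotient.sound (PreHom₂.exchange P Q)).symm
  pentagon f g h i := by
    simp only [eqToIso.hom, whiskerLeft_eqToHom₂, eqToHom₂_whiskerRight, eqToHom_trans]
  triangle f g := by
    simp only [eqToIso.hom, whiskerLeft_eqToHom₂, eqToHom₂_whiskerRight, eqToHom_trans]

instance strict : Strict (Trans μ) where
  id_comp := id_comp₁
  comp_id := comp_id₁
  assoc := assoc₁
  leftUnitor_eqToIso _ := rfl
  rightUnitor_eqToIso _ := rfl
  associator_eqToIso _ _ _ := rfl

end Trans

end TranslationCategory

/-! ### The Quillen construction `S⁻¹X` -/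

section Quillen

variable {S : Type u₁} [Bicategory.{w₁, v₁} S] [Strict S] {M : GrayMonoid S}

theorem prod_heq {B : Type u₁} [Bicategory.{w₁, v₁} B] {C : Type u₂} [Bicategory.{w₂, v₂} C]
    {a b a' b' : B × C} (ha : a = a') (hb : b = b') {f : a ⟶ b} {f' : a' ⟶ b'}
    (h₁ : HEq f.1 f'.1) (h₂ : HEq f.2 f'.2) : HEq f f' := by
  subst ha hb
  exact heq_of_eq (Prod.ext (eq_of_heq h₁) (eq_of_heq h₂))

theorem prod_heq₂ {B : Type u₁} [Bicategory.{w₁, v₁} B] {C : Type u₂} [Bicategory.{w₂, v₂} C]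
    {a b a' b' : B × C} (ha : a = a') (hb : b = b') {f g : a ⟶ b} {f' g' : a' ⟶ b'}
    (hf : HEq f f') (hg : HEq g g') {η : f ⟶ g} {η' : f' ⟶ g'}
    (h₁ : HEq η.1 η'.1) (h₂ : HEq η.2 η'.2) : HEq η η' := by
  subst ha hb
  cases hf; cases hg
  exact heq_of_eq (Prod.ext (eq_of_heq h₁) (eq_of_heq h₂))

/-- A Gray monoid acts on itself. -/
def GrayMonoid.selfAction (M : GrayMonoid S) : M.Action S := ⟨M.tensor, M.assoc, M.unit_left⟩

/-- The terminal 2-category. -/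
abbrev Pt : Type := LocallyDiscrete (Discrete PUnit.{1})

instance (a b : Pt) : Subsingleton (a ⟶ b) := ⟨fun _ _ => Discrete.ext (Subsingleton.elim _ _)⟩

instance : Subsingleton Pt := ⟨by rintro ⟨⟨⟩⟩ ⟨⟨⟩⟩; rfl⟩

theorem Pt.cell_heq {a b a' b' : Pt} {f g : a ⟶ b} {f' g' : a' ⟶ b'} (η : f ⟶ g)
    (η' : f' ⟶ g') : HEq η η' := by
  obtain rfl := Subsingleton.elim a a'
  obtain rfl := Subsingleton.elim b b'
  obtain rfl := Subsingleton.elim f f'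
  obtain rfl := Subsingleton.elim g g'
  exact heq_of_eq (Subsingleton.elim _ _)

/-- The unique action on the terminal 2-category. -/
def GrayMonoid.trivialAction (M : GrayMonoid S) : M.Action Pt where
  act :=
    { obj := fun _ y => y
      mapL := fun _ y => 𝟙 y
      mapR := fun _ _ _ g => g
      mapL₂ := fun _ _ => 𝟙 _
      mapR₂ := fun _ _ _ _ _ θ => θ
      sigma := fun _ _ _ _ => eqToIso (Subsingleton.elim _ _)
      mapL_id := by intros; rfl
      mapL_comp := by intros; rfl
      mapL₂_id := by intros; rfl
      mapL₂_comp := by intros; rfl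
      mapL₂_whiskerLeft := by intros; exact Pt.cell_heq _ _
      mapL₂_whiskerRight := by intros; exact Pt.cell_heq _ _
      mapR_id := by intros; rfl
      mapR_comp := by intros; rfl
      mapR₂_id := by intros; rfl
      mapR₂_comp := by intros; rfl
      mapR₂_whiskerLeft := by intros; exact HEq.rfl
      mapR₂_whiskerRight := by intros; exact HEq.rfl
      sigma_natL := by intros; exact Subsingleton.elim _ _
      sigma_natR := by intros; exact Subsingleton.elim _ _
      sigma_idL := by intros; exact Pt.cell_heq _ _
      sigma_idR := by intros; exact Pt.cell_heq _ _
      sigma_compL := by intros; exact Pt.cell_heq _ _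
      sigma_compR := by intros; exact Pt.cell_heq _ _ }
  assoc :=
    { obj_eq := by intros; rfl
      map₁ := by intros; exact HEq.rfl
      map₂ := by intros; exact HEq.rfl
      map₃ := by intros; exact HEq.rfl
      cell₁ := by intros; exact HEq.rfl
      cell₂ := by intros; exact HEq.rfl
      cell₃ := by intros; exact HEq.rfl
      sigma₁₂ := by intros; exact Pt.cell_heq _ _
      sigma₁₃ := by intros; exact Pt.cell_heq _ _
      sigma₂₃ := by intros; exact Pt.cell_heq _ _ }
  unit_left :=
    { obj_eq := by intros; rfl
      map := by intros; exact HEq.rfl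
      cell := by intros; exact HEq.rfl }

namespace GrayFunctor

variable {A : Type u₁} [Bicategory.{w₁, v₁} A] [Strict A]
  {B : Type u₂} [Bicategory.{w₂, v₂} B] [Strict B]
  {C : Type u₃} [Bicategory.{w₃, v₃} C] [Strict C] (μ : GrayFunctor A B C)

theorem comp_mapL_id (a : A) {b b' : B} (g : b ⟶ b') :
    μ.mapR a g ≫ μ.mapL (𝟙 a) b' = μ.mapR a g := by
  rw [μ.mapL_id, Strict.comp_id]

theorem mapL_id_comp (a : A) {b b' : B} (g : b ⟶ b') :
    μ.mapL (𝟙 a) b ≫ μ.mapR a g = μ.mapR a g := by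
  rw [μ.mapL_id, Strict.id_comp]

theorem mapR_id_comp {a a' : A} (f : a ⟶ a') (b : B) :
    μ.mapR a (𝟙 b) ≫ μ.mapL f b = μ.mapL f b := by
  rw [μ.mapR_id, Strict.id_comp]

theorem comp_mapR_id {a a' : A} (f : a ⟶ a') (b : B) :
    μ.mapL f b ≫ μ.mapR a' (𝟙 b) = μ.mapL f b := by
  rw [μ.mapR_id, Strict.comp_id]

theorem comp_mapL_comp {a a' a'' : A} (f : a ⟶ a') (f' : a' ⟶ a'') {b b' : B} (g : b ⟶ b') :
    μ.mapR a g ≫ μ.mapL (f ≫ f') b' = (μ.mapR a g ≫ μ.mapL f b') ≫ μ.mapL f' b' := by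
  rw [μ.mapL_comp, Strict.assoc]

theorem mapL_comp_comp {a a' a'' : A} (f : a ⟶ a') (f' : a' ⟶ a'') {b b' : B} (g : b ⟶ b') :
    μ.mapL (f ≫ f') b ≫ μ.mapR a'' g = μ.mapL f b ≫ μ.mapL f' b ≫ μ.mapR a'' g := by
  rw [μ.mapL_comp, Strict.assoc]

theorem mapR_comp_comp {a a' : A} (f : a ⟶ a') {b b' b'' : B} (g : b ⟶ b') (g' : b' ⟶ b'') :
    μ.mapR a (g ≫ g') ≫ μ.mapL f b'' = μ.mapR a g ≫ μ.mapR a g' ≫ μ.mapL f b'' := by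
  rw [μ.mapR_comp, Strict.assoc]

theorem comp_mapR_comp {a a' : A} (f : a ⟶ a') {b b' b'' : B} (g : b ⟶ b') (g' : b' ⟶ b'') :
    μ.mapL f b ≫ μ.mapR a' (g ≫ g') = (μ.mapL f b ≫ μ.mapR a' g) ≫ μ.mapR a' g' := by
  rw [μ.mapR_comp, Strict.assoc]

end GrayFunctor

namespace GrayFunctor.IsAssociative

variable {m : GrayFunctor S S S} {Y : Type u₂} [Bicategory.{w₂, v₂} Y] [Strict Y]
  {μ : GrayFunctor S Y Y} 

theorem comp_heq_src₁₂ (h : m.IsAssociative μ) {a a' b b' : S} (f : a ⟶ a') (g : b ⟶ b') (y : Y) :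
    HEq (μ.mapL (m.mapR a g ≫ m.mapL f b') y)
      (μ.mapR a (μ.mapL g y) ≫ μ.mapL f (μ.obj b' y)) := by
  rw [μ.mapL_comp]
  exact comp_heq (h.obj_eq _ _ _) (h.obj_eq _ _ _) (h.obj_eq _ _ _) (h.map₂ _ _ _) (h.map₁ _ _ _)

theorem comp_heq_tgt₁₂ (h : m.IsAssociative μ)
    {a a' b b' : S} (f : a ⟶ a') (g : b ⟶ b') (y : Y) :
    HEq (μ.mapL (m.mapL f b ≫ m.mapR a' g) y)
      (μ.mapL f (μ.obj b y) ≫ μ.mapR a' (μ.mapL g y)) := by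
  rw [μ.mapL_comp]
  exact comp_heq (h.obj_eq _ _ _) (h.obj_eq _ _ _) (h.obj_eq _ _ _) (h.map₁ _ _ _) (h.map₂ _ _ _)

theorem comp_heq_src₁₃ (h : m.IsAssociative μ)
    {a a' : S} (f : a ⟶ a') (b : S) {y y' : Y} (k : y ⟶ y') :
    HEq (μ.mapR (m.obj a b) k ≫ μ.mapL (m.mapL f b) y')
      (μ.mapR a (μ.mapR b k) ≫ μ.mapL f (μ.obj b y')) :=
  comp_heq (h.obj_eq _ _ _) (h.obj_eq _ _ _) (h.obj_eq _ _ _) (h.map₃ _ _ _) (h.map₁ _ _ _)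

theorem comp_heq_tgt₁₃ (h : m.IsAssociative μ)
    {a a' : S} (f : a ⟶ a') (b : S) {y y' : Y} (k : y ⟶ y') :
    HEq (μ.mapL (m.mapL f b) y ≫ μ.mapR (m.obj a' b) k)
      (μ.mapL f (μ.obj b y) ≫ μ.mapR a' (μ.mapR b k)) :=
  comp_heq (h.obj_eq _ _ _) (h.obj_eq _ _ _) (h.obj_eq _ _ _) (h.map₁ _ _ _) (h.map₃ _ _ _)

theorem comp_heq_src₂₃ (h : m.IsAssociative μ)
    (a : S) {b b' : S} (g : b ⟶ b') {y y' : Y} (k : y ⟶ y') :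
    HEq (μ.mapR (m.obj a b) k ≫ μ.mapL (m.mapR a g) y')
      (μ.mapR a (μ.mapR b k ≫ μ.mapL g y')) := by
  rw [μ.mapR_comp]
  exact comp_heq (h.obj_eq _ _ _) (h.obj_eq _ _ _) (h.obj_eq _ _ _) (h.map₃ _ _ _) (h.map₂ _ _ _)

theorem comp_heq_tgt₂₃ (h : m.IsAssociative μ)
    (a : S) {b b' : S} (g : b ⟶ b') {y y' : Y} (k : y ⟶ y') :
    HEq (μ.mapL (m.mapR a g) y ≫ μ.mapR (m.obj a b') k)
      (μ.mapR a (μ.mapL g y ≫ μ.mapR b' k)) := by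
  rw [μ.mapR_comp]
  exact comp_heq (h.obj_eq _ _ _) (h.obj_eq _ _ _) (h.obj_eq _ _ _) (h.map₂ _ _ _) (h.map₃ _ _ _)

end GrayFunctor.IsAssociative

/-- The diagonal action of `S` on `X × Y`. -/
def GrayMonoid.Action.prod {X : Type u₂} [Bicategory.{w₂, v₂} X] [Strict X]
    {Y : Type u₃} [Bicategory.{w₃, v₃} Y] [Strict Y] (μ : M.Action X) (ν : M.Action Y) :
    M.Action (X × Y) where
  act :=
    { obj := fun s z => (μ.act.obj s z.1, ν.act.obj s z.2)
      mapL := fun f z => (μ.act.mapL f z.1, ν.act.mapL f z.2)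
      mapR := fun s _ _ g => (μ.act.mapR s g.1, ν.act.mapR s g.2)
      mapL₂ := fun η z => (μ.act.mapL₂ η z.1, ν.act.mapL₂ η z.2)
      mapR₂ := fun s _ _ _ _ θ => (μ.act.mapR₂ s θ.1, ν.act.mapR₂ s θ.2)
      sigma := fun f _ _ g => Iso.prod (μ.act.sigma f g.1) (ν.act.sigma f g.2)
      mapL_id := by intros; exact Prod.ext (μ.act.mapL_id _ _) (ν.act.mapL_id _ _)
      mapL_comp := by intros; exact Prod.ext (μ.act.mapL_comp _ _ _) (ν.act.mapL_comp _ _ _)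
      mapL₂_id := by intros; exact Prod.ext (μ.act.mapL₂_id _ _) (ν.act.mapL₂_id _ _)
      mapL₂_comp := by intros; exact Prod.ext (μ.act.mapL₂_comp _ _ _) (ν.act.mapL₂_comp _ _ _)
      mapL₂_whiskerLeft := by
        intros
        exact prod_heq₂ rfl rfl
          (heq_of_eq (Prod.ext (μ.act.mapL_comp _ _ _) (ν.act.mapL_comp _ _ _)))
          (heq_of_eq (Prod.ext (μ.act.mapL_comp _ _ _) (ν.act.mapL_comp _ _ _)))
          (μ.act.mapL₂_whiskerLeft _ _ _) (ν.act.mapL₂_whiskerLeft _ _ _)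
      mapL₂_whiskerRight := by
        intros
        exact prod_heq₂ rfl rfl
          (heq_of_eq (Prod.ext (μ.act.mapL_comp _ _ _) (ν.act.mapL_comp _ _ _)))
          (heq_of_eq (Prod.ext (μ.act.mapL_comp _ _ _) (ν.act.mapL_comp _ _ _)))
          (μ.act.mapL₂_whiskerRight _ _ _) (ν.act.mapL₂_whiskerRight _ _ _)
      mapR_id := by intros; exact Prod.ext (μ.act.mapR_id _ _) (ν.act.mapR_id _ _)
      mapR_comp := by intros; exact Prod.ext (μ.act.mapR_comp _ _ _) (ν.act.mapR_comp _ _ _)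
      mapR₂_id := by intros; exact Prod.ext (μ.act.mapR₂_id _ _) (ν.act.mapR₂_id _ _)
      mapR₂_comp := by intros; exact Prod.ext (μ.act.mapR₂_comp _ _ _) (ν.act.mapR₂_comp _ _ _)
      mapR₂_whiskerLeft := by
        intros
        exact prod_heq₂ rfl rfl
          (heq_of_eq (Prod.ext (μ.act.mapR_comp _ _ _) (ν.act.mapR_comp _ _ _)))
          (heq_of_eq (Prod.ext (μ.act.mapR_comp _ _ _) (ν.act.mapR_comp _ _ _)))
          (μ.act.mapR₂_whiskerLeft _ _ _) (ν.act.mapR₂_whiskerLeft _ _ _)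
      mapR₂_whiskerRight := by
        intros
        exact prod_heq₂ rfl rfl
          (heq_of_eq (Prod.ext (μ.act.mapR_comp _ _ _) (ν.act.mapR_comp _ _ _)))
          (heq_of_eq (Prod.ext (μ.act.mapR_comp _ _ _) (ν.act.mapR_comp _ _ _)))
          (μ.act.mapR₂_whiskerRight _ _ _) (ν.act.mapR₂_whiskerRight _ _ _)
      sigma_natL := by intros; exact Prod.ext (μ.act.sigma_natL _ _) (ν.act.sigma_natL _ _)
      sigma_natR := by intros; exact Prod.ext (μ.act.sigma_natR _ _) (ν.act.sigma_natR _ _)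
      sigma_idL := by
        intros
        exact prod_heq₂ rfl rfl
          (heq_of_eq (Prod.ext (μ.act.comp_mapL_id _ _) (ν.act.comp_mapL_id _ _)))
          (heq_of_eq (Prod.ext (μ.act.mapL_id_comp _ _) (ν.act.mapL_id_comp _ _)))
          (μ.act.sigma_idL _ _) (ν.act.sigma_idL _ _)
      sigma_idR := by
        intros
        exact prod_heq₂ rfl rfl
          (heq_of_eq (Prod.ext (μ.act.mapR_id_comp _ _) (ν.act.mapR_id_comp _ _)))
          (heq_of_eq (Prod.ext (μ.act.comp_mapR_id _ _) (ν.act.comp_mapR_id _ _)))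
          (μ.act.sigma_idR _ _) (ν.act.sigma_idR _ _)
      sigma_compL := by
        intros
        exact prod_heq₂ rfl rfl
          (heq_of_eq (Prod.ext (μ.act.comp_mapL_comp _ _ _) (ν.act.comp_mapL_comp _ _ _)))
          (heq_of_eq (Prod.ext (μ.act.mapL_comp_comp _ _ _) (ν.act.mapL_comp_comp _ _ _)))
          (μ.act.sigma_compL _ _ _) (ν.act.sigma_compL _ _ _)
      sigma_compR := by
        intros
        exact prod_heq₂ rfl rfl
          (heq_of_eq (Prod.ext (μ.act.mapR_comp_comp _ _ _) (ν.act.mapR_comp_comp _ _ _)))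
          (heq_of_eq (Prod.ext (μ.act.comp_mapR_comp _ _ _) (ν.act.comp_mapR_comp _ _ _)))
          (μ.act.sigma_compR _ _ _) (ν.act.sigma_compR _ _ _) }
  assoc :=
    { obj_eq := by intros; exact Prod.ext (μ.assoc.obj_eq _ _ _) (ν.assoc.obj_eq _ _ _)
      map₁ := by
        intros
        exact prod_heq (Prod.ext (μ.assoc.obj_eq _ _ _) (ν.assoc.obj_eq _ _ _))
          (Prod.ext (μ.assoc.obj_eq _ _ _) (ν.assoc.obj_eq _ _ _))
          (μ.assoc.map₁ _ _ _) (ν.assoc.map₁ _ _ _)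
      map₂ := by
        intros
        exact prod_heq (Prod.ext (μ.assoc.obj_eq _ _ _) (ν.assoc.obj_eq _ _ _))
          (Prod.ext (μ.assoc.obj_eq _ _ _) (ν.assoc.obj_eq _ _ _))
          (μ.assoc.map₂ _ _ _) (ν.assoc.map₂ _ _ _)
      map₃ := by
        intros
        exact prod_heq (Prod.ext (μ.assoc.obj_eq _ _ _) (ν.assoc.obj_eq _ _ _))
          (Prod.ext (μ.assoc.obj_eq _ _ _) (ν.assoc.obj_eq _ _ _))
          (μ.assoc.map₃ _ _ _) (ν.assoc.map₃ _ _ _)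
      cell₁ := by
        intros
        exact prod_heq₂ (Prod.ext (μ.assoc.obj_eq _ _ _) (ν.assoc.obj_eq _ _ _))
          (Prod.ext (μ.assoc.obj_eq _ _ _) (ν.assoc.obj_eq _ _ _))
          (prod_heq (Prod.ext (μ.assoc.obj_eq _ _ _) (ν.assoc.obj_eq _ _ _))
            (Prod.ext (μ.assoc.obj_eq _ _ _) (ν.assoc.obj_eq _ _ _))
            (μ.assoc.map₁ _ _ _) (ν.assoc.map₁ _ _ _))
          (prod_heq (Prod.ext (μ.assoc.obj_eq _ _ _) (ν.assoc.obj_eq _ _ _))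
            (Prod.ext (μ.assoc.obj_eq _ _ _) (ν.assoc.obj_eq _ _ _))
            (μ.assoc.map₁ _ _ _) (ν.assoc.map₁ _ _ _))
          (μ.assoc.cell₁ _ _ _) (ν.assoc.cell₁ _ _ _)
      cell₂ := by
        intros
        exact prod_heq₂ (Prod.ext (μ.assoc.obj_eq _ _ _) (ν.assoc.obj_eq _ _ _))
          (Prod.ext (μ.assoc.obj_eq _ _ _) (ν.assoc.obj_eq _ _ _))
          (prod_heq (Prod.ext (μ.assoc.obj_eq _ _ _) (ν.assoc.obj_eq _ _ _))
            (Prod.ext (μ.assoc.obj_eq _ _ _) (ν.assoc.obj_eq _ _ _))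
            (μ.assoc.map₂ _ _ _) (ν.assoc.map₂ _ _ _))
          (prod_heq (Prod.ext (μ.assoc.obj_eq _ _ _) (ν.assoc.obj_eq _ _ _))
            (Prod.ext (μ.assoc.obj_eq _ _ _) (ν.assoc.obj_eq _ _ _))
            (μ.assoc.map₂ _ _ _) (ν.assoc.map₂ _ _ _))
          (μ.assoc.cell₂ _ _ _) (ν.assoc.cell₂ _ _ _)
      cell₃ := by
        intros
        exact prod_heq₂ (Prod.ext (μ.assoc.obj_eq _ _ _) (ν.assoc.obj_eq _ _ _))
          (Prod.ext (μ.assoc.obj_eq _ _ _) (ν.assoc.obj_eq _ _ _))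
          (prod_heq (Prod.ext (μ.assoc.obj_eq _ _ _) (ν.assoc.obj_eq _ _ _))
            (Prod.ext (μ.assoc.obj_eq _ _ _) (ν.assoc.obj_eq _ _ _))
            (μ.assoc.map₃ _ _ _) (ν.assoc.map₃ _ _ _))
          (prod_heq (Prod.ext (μ.assoc.obj_eq _ _ _) (ν.assoc.obj_eq _ _ _))
            (Prod.ext (μ.assoc.obj_eq _ _ _) (ν.assoc.obj_eq _ _ _))
            (μ.assoc.map₃ _ _ _) (ν.assoc.map₃ _ _ _))
          (μ.assoc.cell₃ _ _ _) (ν.assoc.cell₃ _ _ _)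
      sigma₁₂ := by
        intros
        exact prod_heq₂ (Prod.ext (μ.assoc.obj_eq _ _ _) (ν.assoc.obj_eq _ _ _))
          (Prod.ext (μ.assoc.obj_eq _ _ _) (ν.assoc.obj_eq _ _ _))
          (prod_heq (Prod.ext (μ.assoc.obj_eq _ _ _) (ν.assoc.obj_eq _ _ _))
            (Prod.ext (μ.assoc.obj_eq _ _ _) (ν.assoc.obj_eq _ _ _))
            (μ.assoc.comp_heq_src₁₂ _ _ _) (ν.assoc.comp_heq_src₁₂ _ _ _))
          (prod_heq (Prod.ext (μ.assoc.obj_eq _ _ _) (ν.assoc.obj_eq _ _ _))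
            (Prod.ext (μ.assoc.obj_eq _ _ _) (ν.assoc.obj_eq _ _ _))
            (μ.assoc.comp_heq_tgt₁₂ _ _ _) (ν.assoc.comp_heq_tgt₁₂ _ _ _))
          (μ.assoc.sigma₁₂ _ _ _) (ν.assoc.sigma₁₂ _ _ _)
      sigma₁₃ := by
        intros
        exact prod_heq₂ (Prod.ext (μ.assoc.obj_eq _ _ _) (ν.assoc.obj_eq _ _ _))
          (Prod.ext (μ.assoc.obj_eq _ _ _) (ν.assoc.obj_eq _ _ _))
          (prod_heq (Prod.ext (μ.assoc.obj_eq _ _ _) (ν.assoc.obj_eq _ _ _))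
            (Prod.ext (μ.assoc.obj_eq _ _ _) (ν.assoc.obj_eq _ _ _))
            (μ.assoc.comp_heq_src₁₃ _ _ _) (ν.assoc.comp_heq_src₁₃ _ _ _))
          (prod_heq (Prod.ext (μ.assoc.obj_eq _ _ _) (ν.assoc.obj_eq _ _ _))
            (Prod.ext (μ.assoc.obj_eq _ _ _) (ν.assoc.obj_eq _ _ _))
            (μ.assoc.comp_heq_tgt₁₃ _ _ _) (ν.assoc.comp_heq_tgt₁₃ _ _ _))
          (μ.assoc.sigma₁₃ _ _ _) (ν.assoc.sigma₁₃ _ _ _)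
      sigma₂₃ := by
        intros
        exact prod_heq₂ (Prod.ext (μ.assoc.obj_eq _ _ _) (ν.assoc.obj_eq _ _ _))
          (Prod.ext (μ.assoc.obj_eq _ _ _) (ν.assoc.obj_eq _ _ _))
          (prod_heq (Prod.ext (μ.assoc.obj_eq _ _ _) (ν.assoc.obj_eq _ _ _))
            (Prod.ext (μ.assoc.obj_eq _ _ _) (ν.assoc.obj_eq _ _ _))
            (μ.assoc.comp_heq_src₂₃ _ _ _) (ν.assoc.comp_heq_src₂₃ _ _ _))
          (prod_heq (Prod.ext (μ.assoc.obj_eq _ _ _) (ν.assoc.obj_eq _ _ _))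
            (Prod.ext (μ.assoc.obj_eq _ _ _) (ν.assoc.obj_eq _ _ _))
            (μ.assoc.comp_heq_tgt₂₃ _ _ _) (ν.assoc.comp_heq_tgt₂₃ _ _ _))
          (μ.assoc.sigma₂₃ _ _ _) (ν.assoc.sigma₂₃ _ _ _) }
  unit_left :=
    { obj_eq := by intros; exact Prod.ext (μ.unit_left.obj_eq _) (ν.unit_left.obj_eq _)
      map := by
        intros
        exact prod_heq (Prod.ext (μ.unit_left.obj_eq _) (ν.unit_left.obj_eq _))
          (Prod.ext (μ.unit_left.obj_eq _) (ν.unit_left.obj_eq _))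
          (μ.unit_left.map _) (ν.unit_left.map _)
      cell := by
        intros
        exact prod_heq₂ (Prod.ext (μ.unit_left.obj_eq _) (ν.unit_left.obj_eq _))
          (Prod.ext (μ.unit_left.obj_eq _) (ν.unit_left.obj_eq _))
          (prod_heq (Prod.ext (μ.unit_left.obj_eq _) (ν.unit_left.obj_eq _))
            (Prod.ext (μ.unit_left.obj_eq _) (ν.unit_left.obj_eq _))
            (μ.unit_left.map _) (ν.unit_left.map _))
          (prod_heq (Prod.ext (μ.unit_left.obj_eq _) (ν.unit_left.obj_eq _))
            (Prod.ext (μ.unit_left.obj_eq _) (ν.unit_left.obj_eq _))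
            (μ.unit_left.map _) (ν.unit_left.map _))
          (μ.unit_left.cell _) (ν.unit_left.cell _) }

/-- The 2-category `S⁻¹X` of an action of `S` on `X`: the translation 2-category of the diagonal
action `s.(a, x) = (sa, sx)` of `S` on `S × X`. -/
abbrev SInv {X : Type u₂} [Bicategory.{w₂, v₂} X] [Strict X] (μ : M.Action X) :=
  Trans (M.selfAction.prod μ)

section Projection

variable {X : Type u₂} [Bicategory.{w₂, v₂} X] [Strict X] {μ : M.Action X}

theorem Pt.hom_heq {a b a' b' : Pt} (f : a ⟶ b) (f' : a' ⟶ b') : HEq f f' := by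
  obtain rfl := Subsingleton.elim a a'
  obtain rfl := Subsingleton.elim b b'
  exact heq_of_eq (Subsingleton.elim _ _)

theorem fst_heq {B : Type u₁} [Bicategory.{w₁, v₁} B] {C : Type u₂} [Bicategory.{w₂, v₂} C]
    {a b a' b' : B × C} (ha : a = a') (hb : b = b') {f : a ⟶ b} {f' : a' ⟶ b'}
    (h : HEq f f') : HEq f.1 f'.1 := by
  subst ha hb; cases h; rfl

theorem fst_heq₂ {B : Type u₁} [Bicategory.{w₁, v₁} B] {C : Type u₂} [Bicategory.{w₂, v₂} C]
    {a b a' b' : B × C} (ha : a = a') (hb : b = b') {f g : a ⟶ b} {f' g' : a' ⟶ b'}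
    (hf : HEq f f') (hg : HEq g g') {η : f ⟶ g} {η' : f' ⟶ g'} (h : HEq η η') :
    HEq η.1 η'.1 := by
  subst ha hb; cases hf; cases hg; cases h; rfl

theorem Trans.map_heq {Y : Type u₂} [Bicategory.{w₂, v₂} Y] [Strict Y] {ν : M.Action Y}
    {x y : Trans ν} {f g : x ⟶ y} (h : f = g) : HEq f.map g.map := by
  subst h; rfl

/-- The unique object of the terminal 2-category. -/
abbrev Pt.star : Pt := ⟨⟨PUnit.unit⟩⟩

namespace SInv

/-- `ρ` on objects: `(a, x)` goes to `(a, *)`. -/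
def rhoObj (z : SInv μ) : SInv M.trivialAction := ⟨(z.pt.1, Pt.star)⟩

/-- `ρ` on 1-cells: `(s, (α, φ))` goes to `(s, (α, 1))`. -/
def rhoMap {y z : SInv μ} (f : y ⟶ z) : rhoObj y ⟶ rhoObj z :=
  ⟨f.s, (f.map.1, 𝟙 Pt.star)⟩

/-- `ρ` on representatives of 2-cells: `(p, (A, F))` goes to `(p, (A, 1))`. -/
def rhoPre {y z : SInv μ} {f g : y ⟶ z} (P : Trans.PreHom₂ f g) :
    Trans.PreHom₂ (rhoMap f) (rhoMap g) :=
  ⟨P.p, (P.cell.1, 𝟙 (𝟙 Pt.star))⟩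

theorem rhoPre_rel {y z : SInv μ} {f g : y ⟶ z} {P Q : Trans.PreHom₂ f g} (h : P ≈ Q) :
    rhoPre P ≈ rhoPre Q := by
  obtain ⟨Θ, h⟩ := h
  exact ⟨Θ, Prod.ext (congrArg (fun c => c.1) h :) (Subsingleton.elim _ _)⟩

/-- `ρ` on 2-cells. -/
def rhoMap₂ {y z : SInv μ} {f g : y ⟶ z} (η : f ⟶ g) : rhoMap f ⟶ rhoMap g :=
  Quotient.map rhoPre (fun _ _ h => rhoPre_rel h) η

theorem obj_eq (s t : S) (z : SInv μ) :
    (M.selfAction.prod μ).act.obj (M.tensor.obj s t) z.pt =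
      (M.selfAction.prod μ).act.obj s ((M.selfAction.prod μ).act.obj t z.pt) :=
  (M.selfAction.prod μ).assoc.obj_eq _ _ _

theorem rhoMap_id (z : SInv μ) : rhoMap (𝟙 z) = 𝟙 (rhoObj z) :=
  Trans.hom₁_ext rfl (prod_heq rfl rfl
    ((fst_heq ((M.selfAction.prod μ).unit_left.obj_eq z.pt) rfl (Trans.id_map_heq z)).trans
      (fst_heq ((M.selfAction.prod M.trivialAction).unit_left.obj_eq (rhoObj z).pt) rfl
        (Trans.id_map_heq (rhoObj z))).symm) (Pt.hom_heq _ _))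

theorem rhoMap_comp {x y z : SInv μ} (f : x ⟶ y) (g : y ⟶ z) :
    rhoMap (f ≫ g) = rhoMap f ≫ rhoMap g :=
  Trans.hom₁_ext rfl (prod_heq rfl rfl
    ((fst_heq (obj_eq _ _ _) rfl (Trans.comp_map_heq f g)).trans
      (fst_heq (obj_eq _ _ _) rfl (Trans.comp_map_heq (rhoMap f) (rhoMap g))).symm)
    (Pt.hom_heq _ _))

theorem rhoMap₂_id {y z : SInv μ} (f : y ⟶ z) : rhoMap₂ (𝟙 f) = 𝟙 (rhoMap f) := by
  refine eq_of_heq (Trans.mk_heq rfl rfl HEq.rfl (prod_heq₂ rfl rfl HEq.rfl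
    (heq_of_eq (Prod.ext rfl (Subsingleton.elim _ _))) ?_ (Pt.cell_heq _ _)))
  have e (ν : M.Action Pt) {y z : Trans (M.selfAction.prod ν)} (f : y ⟶ z) :
      f.map = (M.selfAction.prod ν).act.mapL (𝟙 f.s) y.pt ≫ f.map := by
    rw [(M.selfAction.prod ν).act.mapL_id, Strict.id_comp]
  have e' : f.map = (M.selfAction.prod μ).act.mapL (𝟙 f.s) y.pt ≫ f.map := by
    rw [(M.selfAction.prod μ).act.mapL_id, Strict.id_comp]
  exact (fst_heq₂ rfl rfl HEq.rfl (heq_of_eq e'.symm) (Trans.PreHom₂.id_cell_heq f)).trans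
    (fst_heq₂ rfl rfl HEq.rfl (heq_of_eq (e M.trivialAction (rhoMap f)).symm)
      (Trans.PreHom₂.id_cell_heq (rhoMap f))).symm

theorem rhoMap₂_comp {y z : SInv μ} {f g h : y ⟶ z} (η : f ⟶ g) (θ : g ⟶ h) :
    rhoMap₂ (η ≫ θ) = rhoMap₂ η ≫ rhoMap₂ θ := by
  obtain ⟨P⟩ := η
  obtain ⟨Q⟩ := θ
  refine eq_of_heq (Trans.mk_heq rfl rfl HEq.rfl (prod_heq₂ rfl rfl HEq.rfl
    (heq_of_eq (Prod.ext rfl (Subsingleton.elim _ _))) ?_ (Pt.cell_heq _ _)))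
  exact (fst_heq₂ rfl rfl HEq.rfl (heq_of_eq (by rw [← GrayFunctor.mapL_comp]; rfl))
    (Trans.PreHom₂.comp_cell_heq P Q)).trans
    (fst_heq₂ rfl rfl HEq.rfl (heq_of_eq (by rw [← GrayFunctor.mapL_comp]; rfl))
      (Trans.PreHom₂.comp_cell_heq (rhoPre P) (rhoPre Q))).symm

theorem rhoMap₂_whiskerLeft {x y z : SInv μ} (f : x ⟶ y) {g h : y ⟶ z} (η : g ⟶ h) :
    HEq (rhoMap₂ (f ◁ η)) (rhoMap f ◁ rhoMap₂ η) := by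
  obtain ⟨Q⟩ := η
  have t (ν : M.Action X) {x y z : SInv ν} (f : x ⟶ y) {g h : y ⟶ z} (Q : Trans.PreHom₂ g h) :
      HEq ((M.selfAction.prod ν).act.mapL (Q.whiskerLeft f).p x.pt ≫ (f ≫ h).map)
        ((M.selfAction.prod ν).act.mapL Q.p _ ≫
          ((M.selfAction.prod ν).act.mapR h.s f.map ≫ h.map)) :=
    comp_heq (obj_eq _ _ _) (obj_eq _ _ _) rfl ((M.selfAction.prod ν).assoc.map₁ _ _ _)
      (Trans.comp_map_heq f h)
  have t' {x y z : SInv M.trivialAction} (f : x ⟶ y) {g h : y ⟶ z} (Q : Trans.PreHom₂ g h) :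
      HEq ((M.selfAction.prod M.trivialAction).act.mapL (Q.whiskerLeft f).p x.pt ≫ (f ≫ h).map)
        ((M.selfAction.prod M.trivialAction).act.mapL Q.p _ ≫
          ((M.selfAction.prod M.trivialAction).act.mapR h.s f.map ≫ h.map)) :=
    comp_heq (obj_eq _ _ _) (obj_eq _ _ _) rfl
      ((M.selfAction.prod M.trivialAction).assoc.map₁ _ _ _) (Trans.comp_map_heq f h)
  refine Trans.mk_heq (rhoMap_comp _ _) (rhoMap_comp _ _) HEq.rfl (prod_heq₂ rfl rfl
    (Trans.map_heq (rhoMap_comp f g))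
    ?_ ?_ (Pt.cell_heq _ _))
  · exact comp_heq rfl rfl rfl HEq.rfl (Trans.map_heq (rhoMap_comp f h))
  exact (fst_heq₂ (obj_eq _ _ _) rfl (Trans.comp_map_heq f g) (t μ f Q)
    (Trans.PreHom₂.whiskerLeft_cell_heq f Q)).trans
    (fst_heq₂ (obj_eq _ _ _) rfl (Trans.comp_map_heq (rhoMap f) (rhoMap g))
      (t' (rhoMap f) (rhoPre Q)) (Trans.PreHom₂.whiskerLeft_cell_heq (rhoMap f) (rhoPre Q))).symm

theorem rhoMap₂_whiskerRight {x y z : SInv μ} {f g : x ⟶ y} (η : f ⟶ g) (h : y ⟶ z) :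
    HEq (rhoMap₂ (η ▷ h)) (rhoMap₂ η ▷ rhoMap h) := by
  obtain ⟨P⟩ := η
  have t (ν : M.Action X) {x y z : SInv ν} {f g : x ⟶ y} (P : Trans.PreHom₂ f g) (h : y ⟶ z) :
      HEq ((M.selfAction.prod ν).act.mapL (P.whiskerRight h).p x.pt ≫ (g ≫ h).map)
        ((M.selfAction.prod ν).act.mapR h.s ((M.selfAction.prod ν).act.mapL P.p x.pt) ≫
          ((M.selfAction.prod ν).act.mapR h.s g.map ≫ h.map)) :=
    comp_heq (obj_eq _ _ _) (obj_eq _ _ _) rfl ((M.selfAction.prod ν).assoc.map₂ _ _ _)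
      (Trans.comp_map_heq g h)
  have t' {x y z : SInv M.trivialAction} {f g : x ⟶ y} (P : Trans.PreHom₂ f g) (h : y ⟶ z) :
      HEq ((M.selfAction.prod M.trivialAction).act.mapL (P.whiskerRight h).p x.pt ≫ (g ≫ h).map)
        ((M.selfAction.prod M.trivialAction).act.mapR h.s
          ((M.selfAction.prod M.trivialAction).act.mapL P.p x.pt) ≫
          ((M.selfAction.prod M.trivialAction).act.mapR h.s g.map ≫ h.map)) :=
    comp_heq (obj_eq _ _ _) (obj_eq _ _ _) rfl
      ((M.selfAction.prod M.trivialAction).assoc.map₂ _ _ _) (Trans.comp_map_heq g h)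
  refine Trans.mk_heq (rhoMap_comp _ _) (rhoMap_comp _ _) HEq.rfl (prod_heq₂ rfl rfl
    (Trans.map_heq (rhoMap_comp f h))
    ?_ ?_ (Pt.cell_heq _ _))
  · exact comp_heq rfl rfl rfl HEq.rfl (Trans.map_heq (rhoMap_comp g h))
  refine (fst_heq₂ (obj_eq _ _ _) rfl (Trans.comp_map_heq f h) (t μ P h)
    (Trans.PreHom₂.whiskerRight_cell_heq P h)).trans
    (HEq.trans ?_ (fst_heq₂ (obj_eq _ _ _) rfl (Trans.comp_map_heq (rhoMap f) (rhoMap h))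
      (t' (rhoPre P) (rhoMap h))
      (Trans.PreHom₂.whiskerRight_cell_heq (rhoPre P) (rhoMap h))).symm)
  have p {B : Type u₁} [Bicategory.{w₁, v₁} B] {C : Type u₂} [Bicategory.{w₂, v₂} C]
      {a a' b c : B × C} {π : a ⟶ a'} {ρ : a ⟶ b} {α : a ⟶ b} {α' : a' ⟶ b} (A : α ⟶ ρ)
      (e : ρ = π ≫ α') (γ : b ⟶ c) : (pasteR (A ≫ eqToHom e) γ).1 =
        pasteR (A.1 ≫ eqToHom (congrArg (fun k : a ⟶ b => k.1) e)) γ.1 := by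
    subst e; rfl
  have p' {B : Type u₁} [Bicategory.{w₁, v₁} B] {C : Type} [Bicategory.{0, 0} C]
      {a a' b c : B × C} {π : a ⟶ a'} {ρ : a ⟶ b} {α : a ⟶ b} {α' : a' ⟶ b} (A : α ⟶ ρ)
      (e : ρ = π ≫ α') (γ : b ⟶ c) : (pasteR (A ≫ eqToHom e) γ).1 =
        pasteR (A.1 ≫ eqToHom (congrArg (fun k : a ⟶ b => k.1) e)) γ.1 := by
    subst e; rfl
  have q := p' ((M.selfAction.prod M.trivialAction).act.mapR₂ h.s (rhoPre P).cell)
    ((M.selfAction.prod M.trivialAction).act.mapR_comp h.s _ _) (rhoMap h).map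
  exact heq_of_eq ((p _ _ _).trans q.symm)

end SInv

/-- The projection 2-functor `ρ : S⁻¹X ⟶ S⁻¹*` induced by the unique 2-functor `X ⟶ *`. -/
def rho (μ : M.Action X) : StrictPseudofunctor (SInv μ) (SInv M.trivialAction) :=
  StrictPseudofunctor.mk''
    { obj := SInv.rhoObj
      map := SInv.rhoMap
      map₂ := SInv.rhoMap₂
      map₂_id := SInv.rhoMap₂_id
      map₂_comp := SInv.rhoMap₂_comp
      map_id := SInv.rhoMap_id
      map_comp := SInv.rhoMap_comp
      map₂_whisker_left f g h η := (conj_eqToHom_iff_heq' _ _ (SInv.rhoMap_comp f g)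
        (SInv.rhoMap_comp f h).symm).2 (SInv.rhoMap₂_whiskerLeft f η)
      map₂_whisker_right {_ _ _ f f'} η g := (conj_eqToHom_iff_heq' _ _ (SInv.rhoMap_comp f g)
        (SInv.rhoMap_comp f' g).symm).2 (SInv.rhoMap₂_whiskerRight η g) }

end Projection

end Quillen

/-! ### Opfibrations of 2-categories -/

section Opfibration

variable {K : Type u₁} [Bicategory.{w₁, v₁} K] [Strict K]
  {L : Type u₂} [Bicategory.{w₂, v₂} L] [Strict L] (P : StrictPseudofunctor K L)

/-- The 2-cell `γ : g ⟶ h` is cartesian with respect to `P`. -/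
def IsCartesian₂ {x y : K} {g h : x ⟶ y} (γ : g ⟶ h) : Prop :=
  ∀ (k : x ⟶ y) (ψ : k ⟶ h) (φ : P.map k ⟶ P.map g), P.map₂ ψ = φ ≫ P.map₂ γ →
    ∃! φc : k ⟶ g, P.map₂ φc = φ ∧ φc ≫ γ = ψ

/-- `P` is a local fibration: every 2-cell `α : f ⟶ P g` has a cartesian lift `αc : gc ⟶ g`. -/
def IsLocalFibration : Prop :=
  ∀ {x y : K} (g : x ⟶ y) (f : P.obj x ⟶ P.obj y) (α : f ⟶ P.map g),
    ∃ (gc : x ⟶ y) (αc : gc ⟶ g) (e : P.map gc = f),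
      P.map₂ αc = eqToHom e ≫ α ∧ IsCartesian₂ P αc

/-- Lifts `(t', α₁, α₂)` of `(u, t, α)` along `h`, where `α : P h ≫ t ≅ P u`. -/
structure Lift {a d b : K} (h : a ⟶ d) (u : a ⟶ b) (t : P.obj d ⟶ P.obj b)
    (α : P.map h ≫ t ≅ P.map u) where
  hom : d ⟶ b
  iso₁ : t ≅ P.map hom
  iso₂ : h ≫ hom ≅ u
  fac : P.map h ◁ iso₁.hom ≫ (P.mapComp h hom).inv ≫ P.map₂ iso₂.hom = α.hom

/-- The 1-cell `h : a ⟶ d` is opcartesian with respect to `P`. -/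
structure IsOpcartesian {a d : K} (h : a ⟶ d) : Prop where
  exists_lift {b : K} (u : a ⟶ b) (t : P.obj d ⟶ P.obj b) (α : P.map h ≫ t ≅ P.map u) :
    Nonempty (Lift P h u t α)
  existsUnique {b : K} {t t' : P.obj d ⟶ P.obj b} (β : t ⟶ t') {u u' : a ⟶ b} (σ : u ⟶ u')
    (α : P.map h ≫ t ≅ P.map u) (α' : P.map h ≫ t' ≅ P.map u')
    (l : Lift P h u t α) (l' : Lift P h u' t' α') :
    α.hom ≫ P.map₂ σ = P.map h ◁ β ≫ α'.hom →
      ∃! βc : l.hom ⟶ l'.hom, l.iso₁.hom ≫ P.map₂ βc = β ≫ l'.iso₁.hom ∧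
        l.iso₂.hom ≫ σ = h ◁ βc ≫ l'.iso₂.hom

/-- A 2-functor `P` is an opfibration if 1-cells `f : P x ⟶ z` have opcartesian lifts, `P` is a
local fibration, and horizontal composites of cartesian 2-cells are cartesian. -/
structure IsOpfibration : Prop where
  exists_opcartesian (x : K) (z : L) (f : P.obj x ⟶ z) :
    ∃ (x' : K) (h : x ⟶ x'), P.obj x' = z ∧ HEq (P.map h) f ∧ IsOpcartesian P h
  local_fibration : IsLocalFibration P
  hcomp {x y z : K} {f f' : x ⟶ y} {g g' : y ⟶ z} (η : f ⟶ f') (θ : g ⟶ g') :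
    IsCartesian₂ P η → IsCartesian₂ P θ → IsCartesian₂ P (η ▷ g ≫ f' ◁ θ)

end Opfibration

/-- `S` has faithful translations: each functor `s ⊕ - : S(x, y) ⟶ S(sx, sy)` is faithful. -/
def GrayMonoid.FaithfulTranslations {S : Type u} [Bicategory.{w, v} S] [Strict S]
    (M : GrayMonoid S) : Prop :=
  ∀ (s : S) {x y : S} {f g : x ⟶ y} (α β : f ⟶ g),
    M.tensor.mapR₂ s α = M.tensor.mapR₂ s β → α = β

/-- A 1-cell is invertible if it is an internal equivalence. -/
def IsInvertible₁ {B : Type u} [Bicategory.{w, v} B] {x y : B} (f : x ⟶ y) : Prop :=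
  ∃ g : y ⟶ x, Nonempty (f ≫ g ≅ 𝟙 x) ∧ Nonempty (g ≫ f ≅ 𝟙 y)

/-- The 1-cell `(s, α, 1) : (a, x) ⟶ (d, sx)` of `S⁻¹X`. -/
def SInv.cell {S : Type u₁} [Bicategory.{w₁, v₁} S] [Strict S] {M : GrayMonoid S}
    {X : Type u₂} [Bicategory.{w₂, v₂} X] [Strict X] (μ : M.Action X) (s : S) {a d : S}
    (α : M.tensor.obj s a ⟶ d) (x : X) :
    (⟨(a, x)⟩ : SInv μ) ⟶ (⟨(d, μ.act.obj s x)⟩ : SInv μ) :=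
  ⟨s, (α, 𝟙 (μ.act.obj s x))⟩

end GrayAct

namespace GrayAct

/-! ### Invertible 1-cells and transport of 2-cells -/

section Cells

variable {B : Type u} [Bicategory.{w, v} B]

/-! The proof rests on two facts: every 2-cell of `SInv μ` is invertible, and 2-cells lift uniquely
along precomposition with `(s, α, 1)`.

Invertibility (`Trans.isIso₂`): a 2-cell is a class of a 1-cell `p` of `S` with 2-cells of `S` and
`X`. A quasi-inverse `q` of `p` and the inverses of suitable pastings give an inverse, because
triples are identified along invertible 2-cells `Θ` and `q ≫ p ≅ 𝟙` supplies one. Invertible 2-cells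
are cartesian, so every 2-cell is cartesian. Closure under horizontal composition is then automatic,
and a local fibration only needs some lift of each 2-cell.

Existence of 1-dimensional lifts (`SInv.exists_lift_cell`): let `(t, δ)` be a 1-cell below and let
the given isomorphism be represented by `p : ts ⟶ u.s` and a 2-cell of `S`. The map `t(sx) = (ts)x ⟶
(u.s)x ⟶ y`, made from `p` and the `X`-component of `u`, completes `(t, δ)` to a 1-cell out of `(d,
sx)`. The same `p`, with the identity 2-cell in `X`, is the required comparison.

For the 2-dimensional property, conjugation by the isomorphisms of two lifts
(`isOpcartesian_of_unique_lift`) reduces matters to filling a compatible pair `β : ρk ⟶ ρk'`, `τ : h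
≫ k ⟶ h ≫ k'` for `h = (s, α, 1)`. Whiskering with `h` leaves the `X`-component of a 2-cell
unchanged. Therefore a filler takes its `S`-data from `β` and its `X`-component from `τ`, after
transport along the `Θ` that witnesses compatibility (`SInv.exists_cell_whiskerLeft_eq`).

Uniqueness (`SInv.mk_eq_of_cell_whiskerLeft_eq`) is where faithful translations enter. Two fillers
may be given the same `q` and the same `S`-component. If they agree after whiskering, some `Ξ : qs ≅
qs` matches their `X`-components and fixes an invertible 2-cell of `S`. Hence `Ξ ⊕ a` is an
identity. The braiding turns `- ⊕ a` into `a ⊕ -`, so `Ξ` itself is an identity and the two fillers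
coincide. -/

theorem whiskerRight_id_injective {a b : B} {f g : a ⟶ b} {η θ : f ⟶ g}
    (h : η ▷ 𝟙 b = θ ▷ 𝟙 b) : η = θ := by
  simpa using h

theorem id_whiskerLeft_injective {a b : B} {f g : a ⟶ b} {η θ : f ⟶ g}
    (h : 𝟙 a ◁ η = 𝟙 a ◁ θ) : η = θ := by
  simpa using h

/-- Whiskering on the target side with an invertible 1-cell is faithful. -/
theorem IsInvertible₁.whiskerRight_injective {a b c : B} {k : b ⟶ c} (hk : IsInvertible₁ k)
    {f g : a ⟶ b} {η θ : f ⟶ g} (h : η ▷ k = θ ▷ k) : η = θ := by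
  obtain ⟨l, ⟨e⟩, -⟩ := hk
  have h₁ : η ▷ (k ≫ l) = θ ▷ (k ≫ l) := by
    rw [whiskerRight_comp, whiskerRight_comp, h]
  -- The exchange law makes `e : k ≫ l ≅ 𝟙` natural, so equality after whiskering with `k ≫ l`
  -- becomes equality after whiskering with an identity.
  refine whiskerRight_id_injective ((cancel_epi (f ◁ e.hom)).1 ?_)
  rw [whisker_exchange, whisker_exchange, h₁]

/-- Whiskering on the source side with an invertible 1-cell is faithful. -/
theorem IsInvertible₁.whiskerLeft_injective {a b c : B} {k : a ⟶ b} (hk : IsInvertible₁ k)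
    {f g : b ⟶ c} {η θ : f ⟶ g} (h : k ◁ η = k ◁ θ) : η = θ := by
  obtain ⟨l, -, ⟨e⟩⟩ := hk
  have h₁ : (l ≫ k) ◁ η = (l ≫ k) ◁ θ := by
    rw [comp_whiskerLeft, comp_whiskerLeft, h]
  refine id_whiskerLeft_injective ((cancel_epi (e.hom ▷ f)).1 ?_)
  rw [← whisker_exchange, ← whisker_exchange, h₁]

/-- Cancelling the invertible `η` leaves `θ ▷ k = 𝟙`, and whiskering with `k` is faithful. This
turns "`Ξ` fixes the `S`-component" into "`Ξ ⊕ a` is an identity". -/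
theorem eq_id_of_comp_whiskerRight_eq {a b c : B} {k : b ⟶ c} (hk : IsInvertible₁ k)
    {π : a ⟶ b} {f : a ⟶ c} {η : f ⟶ π ≫ k} [IsIso η] {θ : π ⟶ π} (h : η ≫ θ ▷ k = η) :
    θ = 𝟙 π :=
  hk.whiskerRight_injective (by rw [← cancel_epi η, h, id_whiskerRight, Category.comp_id])

theorem comp_whiskerRight_eq_of_eq_id {a b c : B} {k : b ⟶ c} {π : a ⟶ b} {f : a ⟶ c}
    {η : f ⟶ π ≫ k} {θ : π ⟶ π} (h : θ = 𝟙 π) : η ≫ θ ▷ k = η := by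
  rw [h, id_whiskerRight, Category.comp_id]

/-- A 2-cell can be transported along equalities of its boundary. -/
theorem exists_heq₂ {a a' b b' : B} (ha : a = a') (hb : b = b') {f g : a ⟶ b} {f' g' : a' ⟶ b'}
    (hf : HEq f f') (hg : HEq g g') (η : f ⟶ g) : ∃ η' : f' ⟶ g', HEq η' η := by
  subst ha hb; cases hf; cases hg; exact ⟨η, HEq.rfl⟩

end Cells

/-- The argument that one-sided inverses suffice in a group: `g` has a one-sided inverse `k` in its
turn, and associativity forces `k = f`. It halves the work of inverting 2-cells, which are
equivalence classes. -/
theorem isIso_of_forall_left_inverse {C : Type u} [Category.{v} C]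
    (H : ∀ {x y : C} (f : x ⟶ y), ∃ g : y ⟶ x, g ≫ f = 𝟙 y) {x y : C} (f : x ⟶ y) : IsIso f := by
  obtain ⟨g, hg⟩ := H f
  obtain ⟨k, hk⟩ := H g
  have : k = f := by
    rw [← Category.comp_id k, ← hg, ← Category.assoc, hk, Category.id_comp]
  exact ⟨g, this ▸ hk, hg⟩

theorem snd_heq {B : Type u₁} [Bicategory.{w₁, v₁} B] {C : Type u₂} [Bicategory.{w₂, v₂} C]
    {a b a' b' : B × C} (ha : a = a') (hb : b = b') {f : a ⟶ b} {f' : a' ⟶ b'}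
    (h : HEq f f') : HEq f.2 f'.2 := by
  subst ha hb; cases h; rfl

theorem snd_heq₂ {B : Type u₁} [Bicategory.{w₁, v₁} B] {C : Type u₂} [Bicategory.{w₂, v₂} C]
    {a b a' b' : B × C} (ha : a = a') (hb : b = b') {f g : a ⟶ b} {f' g' : a' ⟶ b'}
    (hf : HEq f f') (hg : HEq g g') {η : f ⟶ g} {η' : f' ⟶ g'} (h : HEq η η') :
    HEq η.2 η'.2 := by
  subst ha hb; cases hf; cases hg; cases h; rfl

theorem isIso_prod₂ {B : Type u₁} [Bicategory.{w₁, v₁} B] {C : Type u₂} [Bicategory.{w₂, v₂} C]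
    (hB : ∀ {a b : B} {f g : a ⟶ b} (η : f ⟶ g), IsIso η)
    (hC : ∀ {a b : C} {f g : a ⟶ b} (η : f ⟶ g), IsIso η)
    {a b : B × C} {f g : a ⟶ b} (η : f ⟶ g) : IsIso η :=
  have := hB η.1
  have := hC η.2
  ⟨(inv η.1, inv η.2), Prod.ext (IsIso.hom_inv_id η.1) (IsIso.hom_inv_id η.2),
    Prod.ext (IsIso.inv_hom_id η.1) (IsIso.inv_hom_id η.2)⟩

/-! ### Invertibility of 2-cells of translation 2-categories -/

theorem Trans.isIso₂ {S : Type u₁} [Bicategory.{w₁, v₁} S] [Strict S] {M : GrayMonoid S}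
    {Y : Type u₂} [Bicategory.{w₂, v₂} Y] [Strict Y] {ν : M.Action Y}
    (hS₁ : ∀ {a b : S} (f : a ⟶ b), IsInvertible₁ f)
    (hY : ∀ {x y : Y} {f g : x ⟶ y} (η : f ⟶ g), IsIso η)
    {x y : Trans ν} {f g : x ⟶ y} (η : f ⟶ g) : IsIso η := by
  refine isIso_of_forall_left_inverse (fun {f g} η => ?_) η
  obtain ⟨P⟩ := η
  obtain ⟨q, -, ⟨Θ⟩⟩ := hS₁ P.p
  -- `E` is the triangle of `P` whiskered with `q` and then closed up by `Θ : q ≫ p ≅ 𝟙`. The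
  -- candidate inverse is `(q, inv E)`: composed with `P` it has the 1-cell `q ≫ p`, and `Θ` itself
  -- relates this composite to the identity, since what remains is `inv E ≫ E`.
  let E : ν.act.mapL q x.pt ≫ f.map ⟶ g.map :=
    ν.act.mapL q x.pt ◁ P.cell ≫ (α_ _ _ _).inv ≫ eqToHom (by rw [ν.act.mapL_comp]) ≫
      ν.act.mapL₂ Θ.hom x.pt ▷ g.map ≫ eqToHom (by rw [ν.act.mapL_id, Strict.id_comp])
  have := hY E
  refine ⟨Quotient.mk (PreHom₂.setoid g f) ⟨q, inv E⟩, Quotient.sound ⟨Θ, ?_⟩⟩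
  simp [PreHom₂.comp, PreHom₂.id, pasteV, E]

/-! ### Opcartesian 1-cells and cartesian 2-cells -/

section Opfibration

variable {K : Type u₁} [Bicategory.{w₁, v₁} K] [Strict K]
  {L : Type u₂} [Bicategory.{w₂, v₂} L] (P : StrictPseudofunctor K L)

theorem isCartesian₂_of_isIso {x y : K} {g h : x ⟶ y} (γ : g ⟶ h) [IsIso γ] :
    IsCartesian₂ P γ := by
  have hγ : P.map₂ γ ≫ P.map₂ (inv γ) = 𝟙 _ := by
    rw [← P.map₂_comp, IsIso.hom_inv_id, P.map₂_id]
  intro k ψ φ h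
  refine ⟨ψ ≫ inv γ, ⟨?_, by simp⟩, fun χ hχ => by simp [← hχ.2]⟩
  rw [P.map₂_comp, h, Category.assoc, hγ, Category.comp_id]

variable [Strict L]

/-- The two-dimensional property of opcartesian 1-cells follows from unique lifting of 2-cells
between 1-cells out of `d` along precomposition with `h`. -/
theorem isOpcartesian_of_unique_lift {a d : K} {h : a ⟶ d}
    (H₁ : ∀ {b : K} (u : a ⟶ b) (t : P.obj d ⟶ P.obj b) (α : P.map h ≫ t ≅ P.map u),
      Nonempty (Lift P h u t α))
    (H₂ : ∀ {b : K} {k k' : d ⟶ b} (β : P.map k ⟶ P.map k') (τ : h ≫ k ⟶ h ≫ k'),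
      (P.mapComp h k).inv ≫ P.map₂ τ = P.map h ◁ β ≫ (P.mapComp h k').inv →
        ∃! βc : k ⟶ k', P.map₂ βc = β ∧ h ◁ βc = τ) : IsOpcartesian P h where
  exists_lift := H₁
  existsUnique {b t t'} β {u u'} σ α α' l l' hσ := by
    have hl := l.fac
    have hl' := l'.fac
    -- The conjugates of `σ` and `β` by the isomorphisms of the two lifts form a compatible pair;
    -- this is the hypothesis on `σ` and `β` rewritten by `l.fac` and `l'.fac`.
    have e : (P.mapComp h l.hom).inv ≫ P.map₂ (l.iso₂.hom ≫ σ ≫ l'.iso₂.inv) =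
        P.map h ◁ (l.iso₁.inv ≫ β ≫ l'.iso₁.hom) ≫ (P.mapComp h l'.hom).inv := by
      have i : P.map₂ l'.iso₂.hom ≫ P.map₂ l'.iso₂.inv = 𝟙 _ := by
        rw [← P.map₂_comp, Iso.hom_inv_id, P.map₂_id]
      rw [← hl, ← hl'] at hσ
      have := (P.map h ◁ l.iso₁.inv) ≫= hσ =≫ P.map₂ l'.iso₂.inv
      simp only [Category.assoc, i, Category.comp_id] at this
      rw [← whiskerLeft_comp_assoc, Iso.inv_hom_id, whiskerLeft_id, Category.id_comp] at this
      simp only [P.map₂_comp, whiskerLeft_comp, Category.assoc, this]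
    obtain ⟨βc, ⟨h₁, h₂⟩, h₃⟩ := H₂ _ _ e
    refine ⟨βc, ⟨by simp [h₁], by simp [h₂]⟩, fun γ hγ => h₃ γ ⟨?_, ?_⟩⟩
    · rw [← hγ.1]; simp
    · rw [← Category.assoc, hγ.2]; simp

end Opfibration

/-! ### Faithfulness of translations on the other side -/

theorem PermutativeGrayMonoid.mapL₂_injective {S : Type u} [Bicategory.{w, v} S] [Strict S]
    (M : PermutativeGrayMonoid S) (hS : M.toGrayMonoid.FaithfulTranslations)
    (hS₁ : ∀ {a b : S} (f : a ⟶ b), IsInvertible₁ f) {s t : S} {f g : s ⟶ t} {η θ : f ⟶ g}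
    (a : S) (h : M.tensor.mapL₂ η a = M.tensor.mapL₂ θ a) : η = θ := by
  -- The braiding is 2-natural, so whiskering `a ⊕ η` with it agrees with whiskering `η ⊕ a` with
  -- it. It is an invertible 1-cell, hence can be cancelled, and faithfulness of `a ⊕ -` applies.
  refine hS a _ _ ((hS₁ (M.braid s a)).whiskerLeft_injective ?_)
  exact eq_of_heq ((M.braid_natL₂ η a).symm.trans
    ((heq_of_eq (by rw [h])).trans (M.braid_natL₂ θ a)))

/-! ### Cells of `S⁻¹*` and the local fibration property of `ρ` -/

section Projection

variable {S : Type u₁} [Bicategory.{w₁, v₁} S] [Strict S] {M : GrayMonoid S}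
  {X : Type u₂} [Bicategory.{w₂, v₂} X] [Strict X] {μ : M.Action X}

/-- Since `ρ` preserves composites through an equality of 1-cells that need not be definitional,
equations between images of 2-cells are heterogeneous. Writing the boundaries as explicit pairs with
common `S`-objects allows the equalities to be substituted away before the witness `Θ` is extracted.
-/
theorem Trans.exists_iso_of_mk_heq {Y : Type u₂} [Bicategory.{w₂, v₂} Y] [Strict Y]
    {ν : M.Action Y} {x y : Trans ν} {s t : S} {m m' : ν.act.obj s x.pt ⟶ y.pt}
    {n n' : ν.act.obj t x.pt ⟶ y.pt} (hm : m = m') (hn : n = n')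
    {P : PreHom₂ (⟨s, m⟩ : x ⟶ y) ⟨t, n⟩} {Q : PreHom₂ (⟨s, m'⟩ : x ⟶ y) ⟨t, n'⟩}
    (h : HEq (Quotient.mk (PreHom₂.setoid _ _) P) (Quotient.mk (PreHom₂.setoid _ _) Q)) :
    ∃ Θ : P.p ≅ Q.p, HEq (P.cell ≫ ν.act.mapL₂ Θ.hom x.pt ▷ n) Q.cell := by
  subst hm hn
  obtain ⟨Θ, h⟩ := Quotient.exact (eq_of_heq h)
  exact ⟨Θ, heq_of_eq h⟩

namespace SInv

theorem hom_ext {y z : SInv M.trivialAction} {f g : y ⟶ z} (h₁ : f.s = g.s)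
    (h₂ : HEq f.map.1 g.map.1) : f = g := by
  obtain ⟨s, m, c⟩ := f
  obtain ⟨t, n, d⟩ := g
  cases h₁; cases h₂
  obtain rfl : c = d := Subsingleton.elim _ _
  rfl

/-- The terminal 2-category has no parallel distinct 2-cells, so in `S⁻¹*` the defining relation
only has to be checked on `S`-components. -/
theorem mk_ext {y z : SInv M.trivialAction} {f g : y ⟶ z} {P Q : Trans.PreHom₂ f g}
    (Θ : P.p ≅ Q.p) (h : P.cell.1 ≫ M.tensor.mapL₂ Θ.hom y.pt.1 ▷ g.map.1 = Q.cell.1) :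
    (Quotient.mk (Trans.PreHom₂.setoid f g) P) = Quotient.mk (Trans.PreHom₂.setoid f g) Q :=
  Quotient.sound ⟨Θ, Prod.ext h (Subsingleton.elim _ _)⟩

theorem isLocalFibration (hiso : ∀ {y z : SInv μ} {f g : y ⟶ z} (η : f ⟶ g), IsIso η) :
    IsLocalFibration (rho μ) := by
  rintro x y g f ⟨Q⟩
  have e : f = ⟨f.s, (f.map.1, 𝟙 Pt.star)⟩ := hom_ext rfl HEq.rfl
  -- The `X`-component of the new source is chosen as exactly the target of the required 2-cell of
  -- `X`, so the identity serves as the `X`-component of the lift. Being invertible, this lift is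
  -- cartesian.
  let f' : x ⟶ y := ⟨f.s, (f.map.1, μ.act.mapL Q.p x.pt.2 ≫ g.map.2)⟩
  have := hiso (Quotient.mk (Trans.PreHom₂.setoid f' g) ⟨Q.p, (Q.cell.1, 𝟙 _)⟩)
  refine ⟨f', Quotient.mk (Trans.PreHom₂.setoid f' g) ⟨Q.p, (Q.cell.1, 𝟙 _)⟩, e.symm, ?_,
    isCartesian₂_of_isIso _ _⟩
  refine eq_of_heq (HEq.trans ?_ (eqToHom_comp_heq _ _).symm)
  exact Trans.mk_heq e.symm rfl HEq.rfl (prod_heq₂ rfl rfl (Trans.map_heq e.symm) HEq.rfl HEq.rfl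
    (Pt.cell_heq _ _))

/-- The second component of the whiskering with `(s, α, 1)` on the source side. -/
theorem cell_whiskerLeft_snd_heq {s a d : S} (α : M.tensor.obj s a ⟶ d) (x : X) {z : SInv μ}
    {k k' : (⟨(d, μ.act.obj s x)⟩ : SInv μ) ⟶ z} (Q : Trans.PreHom₂ k k') :
    HEq (Q.whiskerLeft (cell μ s α x)).cell.2 Q.cell.2 := by
  refine (snd_heq₂ (obj_eq _ _ _) rfl (Trans.comp_map_heq _ _) ?_
    (Trans.PreHom₂.whiskerLeft_cell_heq (cell μ s α x) Q)).trans ?_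
  · exact comp_heq (obj_eq _ _ _) (obj_eq _ _ _) rfl ((M.selfAction.prod μ).assoc.map₁ _ _ _)
      (Trans.comp_map_heq _ _)
  -- The `X`-component of `(s, α, 1)` is an identity, so the interchange cell pasted on is
  -- `Σ_{q,1}`, itself an identity.
  · exact pasteL_id_side (B := X) rfl rfl (heq_of_eq (μ.act.mapR_id _ _))
      (heq_of_eq (μ.act.mapR_id _ _)) HEq.rfl (μ.act.sigma_idR _ _) Q.cell.2

/-- The second component of the composite of `(s, α, 1)` with a 1-cell. -/
theorem cell_comp_map_snd_heq {s a d : S} (α : M.tensor.obj s a ⟶ d) (x : X) {z : SInv μ}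
    (k : (⟨(d, μ.act.obj s x)⟩ : SInv μ) ⟶ z) : HEq (cell μ s α x ≫ k).map.2 k.map.2 :=
  (snd_heq (obj_eq _ _ _) rfl (Trans.comp_map_heq (cell μ s α x) k)).trans
    ((comp_heq (B := X) rfl rfl rfl (heq_of_eq (μ.act.mapR_id _ _)) HEq.rfl).trans
      (heq_of_eq (Strict.id_comp (B := X) k.map.2)))

/-- The composition constraints of `ρ` are transports along equalities, so they disappear up to
`HEq`; likewise when they stand on the other side of `η`. -/
theorem rho_mapComp_inv_comp_heq {x y z : SInv μ} (f : x ⟶ y) (g : y ⟶ z)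
    {k : (rho μ).obj x ⟶ (rho μ).obj z} (η : (rho μ).map (f ≫ g) ⟶ k) :
    HEq (((rho μ).mapComp f g).inv ≫ η) η :=
  eqToHom_comp_heq _ (rhoMap_comp f g).symm

theorem rho_comp_mapComp_inv_heq {x y z : SInv μ} (f : x ⟶ y) (g : y ⟶ z)
    {k : (rho μ).obj x ⟶ (rho μ).obj z} (η : k ⟶ (rho μ).map f ≫ (rho μ).map g) :
    HEq (η ≫ ((rho μ).mapComp f g).inv) η :=
  comp_eqToHom_heq _ (rhoMap_comp f g).symm

/-! ### Lifts of 1-cells along `(s, α, 1)` -/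

theorem exists_lift_cell (hiso : ∀ {y z : SInv μ} {f g : y ⟶ z} (η : f ⟶ g), IsIso η)
    {s a d : S} (α : M.tensor.obj s a ⟶ d) (x : X) {z : SInv μ}
    (u : (⟨(a, x)⟩ : SInv μ) ⟶ z)
    (t : (rho μ).obj ⟨(d, μ.act.obj s x)⟩ ⟶ (rho μ).obj z)
    (A : (rho μ).map (cell μ s α x) ≫ t ≅ (rho μ).map u) :
    Nonempty (Lift (rho μ) (cell μ s α x) u t A) := by
  obtain ⟨t, δ, c⟩ := t
  obtain rfl : c = 𝟙 Pt.star := Subsingleton.elim _ _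
  obtain ⟨Q, hQ⟩ := Quotient.exists_rep A.hom
  -- Here `Q.p : ts ⟶ u.s` comes from a representative of the given isomorphism. Acting on `x`, it
  -- leads from `(ts)x = t(sx)` to the source of the `X`-component of `u`.
  let k : (⟨(d, μ.act.obj s x)⟩ : SInv μ) ⟶ z :=
    ⟨t, (δ, eqToHom (μ.assoc.obj_eq _ _ _).symm ≫ μ.act.mapL Q.p x ≫ u.map.2)⟩
  have e := rhoMap_comp (cell μ s α x) k
  have e₁ : HEq (rhoMap (cell μ s α x) ≫ rhoMap k).map.1 (cell μ s α x ≫ k).map.1 :=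
    heq_of_eq (congrArg (fun c => c.1) (eq_of_heq (Trans.map_heq e).symm))
  have e₂ : HEq (μ.act.mapL Q.p x ≫ u.map.2) (cell μ s α x ≫ k).map.2 :=
    (id_comp_heq _ _).symm.trans (cell_comp_map_snd_heq α x k).symm
  -- `C` and `D` are the `S`-component of the given isomorphism and an identity of `X`, retyped so
  -- that their source is a component of `cell μ s α x ≫ k`.
  obtain ⟨C, hC⟩ := exists_heq₂ rfl rfl e₁ HEq.rfl Q.cell.1
  obtain ⟨D, hD⟩ := exists_heq₂ rfl rfl e₂ HEq.rfl (𝟙 (μ.act.mapL Q.p x ≫ u.map.2))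
  let η : cell μ s α x ≫ k ⟶ u := Quotient.mk (Trans.PreHom₂.setoid _ _) ⟨Q.p, (C, D)⟩
  have := hiso η
  -- `k` lies strictly over `t`, so the first isomorphism of the lift is an identity; the second is
  -- invertible because all 2-cells of `SInv μ` are.
  refine ⟨⟨k, Iso.refl _, asIso η, ?_⟩⟩
  rw [← hQ]
  refine eq_of_heq ((heq_of_eq ((congrArg (· ≫ _) (whiskerLeft_id _ _)).trans
    (Category.id_comp _))).trans ((rho_mapComp_inv_comp_heq (cell μ s α x) k _).trans ?_))
  exact Trans.mk_heq e rfl HEq.rfl (prod_heq₂ rfl rfl (Trans.map_heq e) HEq.rfl hC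
    (Pt.cell_heq _ _))

/-! ### Unique lifting of 2-cells along `(s, α, 1)` -/

/-- This is the uniqueness half for representatives sharing their 1-cell and `S`-component. The
whiskered classes could a priori be identified by a nontrivial `Ξ : ps ≅ ps`, which would allow
different `X`-components; `hM` rules this out. -/
theorem mk_eq_of_cell_whiskerLeft_eq
    (hM : ∀ {s t : S} {f g : s ⟶ t} {η θ : f ⟶ g} (a : S),
      M.tensor.mapL₂ η a = M.tensor.mapL₂ θ a → η = θ)
    (hS₁ : ∀ {a b : S} (f : a ⟶ b), IsInvertible₁ f)
    (hS₂ : ∀ {a b : S} {f g : a ⟶ b} (η : f ⟶ g), IsIso η)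
    {s a d : S} (α : M.tensor.obj s a ⟶ d) (x : X) {z : SInv μ}
    {k k' : (⟨(d, μ.act.obj s x)⟩ : SInv μ) ⟶ z} (p : k.s ⟶ k'.s)
    {C D : k.map ⟶ (M.selfAction.prod μ).act.mapL p (d, μ.act.obj s x) ≫ k'.map}
    (hCD : C.1 = D.1)
    (h : cell μ s α x ◁ (Quotient.mk (Trans.PreHom₂.setoid k k') ⟨p, C⟩) =
      cell μ s α x ◁ (Quotient.mk (Trans.PreHom₂.setoid k k') ⟨p, D⟩)) : C = D := by
  obtain ⟨Ξ, hΞ⟩ := Quotient.exact h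
  let P : Trans.PreHom₂ k k' := ⟨p, C⟩
  let Q : Trans.PreHom₂ k k' := ⟨p, D⟩
  let V := P.whiskerLeft (cell μ s α x)
  let W := Q.whiskerLeft (cell μ s α x)
  have h₁ : V.cell.1 ≫ M.tensor.mapL₂ Ξ.hom a ▷ (cell μ s α x ≫ k').map.1 = W.cell.1 :=
    congrArg (fun c => c.1) hΞ
  have h₂ : V.cell.2 ≫ μ.act.mapL₂ Ξ.hom x ▷ (cell μ s α x ≫ k').map.2 = W.cell.2 :=
    congrArg (fun c => c.2) hΞ
  -- With `p` fixed, the `S`-component of the whiskering depends only on that of the triangle.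
  have h₃ : V.cell.1 = W.cell.1 := by
    change _ ◁ pasteL _ C.1 ≫ _ = _ ◁ pasteL _ D.1 ≫ _
    rw [hCD]
  -- By `h₁` and `h₃`, pasting `Ξ ⊕ a` onto the invertible 2-cell `W.cell.1` does not change it, and
  -- whiskering with the 1-cell that follows is faithful.
  have h₄ : M.tensor.mapL₂ Ξ.hom a = 𝟙 (M.tensor.mapL (M.tensor.mapL p s) a) := by
    have := hS₂ W.cell.1
    exact eq_id_of_comp_whiskerRight_eq (hS₁ (cell μ s α x ≫ k').map.1) (η := W.cell.1)
      ((congrArg (· ≫ M.tensor.mapL₂ Ξ.hom a ▷ (cell μ s α x ≫ k').map.1) h₃).symm.trans h₁)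
  have h₅ : Ξ.hom = 𝟙 (M.tensor.mapL p s) :=
    hM a (h₄.trans (M.tensor.mapL₂_id _ _).symm)
  have h₆ : V.cell.2 = W.cell.2 :=
    -- Since `Ξ` is an identity, so is its action on `x`, and the identification no longer alters
    -- the `X`-component.
    (comp_whiskerRight_eq_of_eq_id
      ((congrArg (μ.act.mapL₂ · x) h₅).trans (μ.act.mapL₂_id _ _))).symm.trans h₂
  exact Prod.ext hCD (eq_of_heq ((cell_whiskerLeft_snd_heq α x P).symm.trans
    ((heq_of_eq h₆).trans (cell_whiskerLeft_snd_heq α x Q))))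

/-- Invertibility plays no part here: a representative of `β` fixes the 1-cell and the
`S`-component, and `τ` fixes the `X`-component once its 1-cell has been moved to that of the
whiskered `β`. -/
theorem exists_cell_whiskerLeft_eq {s a d : S} (α : M.tensor.obj s a ⟶ d) (x : X) {z : SInv μ}
    {k k' : (⟨(d, μ.act.obj s x)⟩ : SInv μ) ⟶ z} (β : (rho μ).map k ⟶ (rho μ).map k')
    (τ : cell μ s α x ≫ k ⟶ cell μ s α x ≫ k')
    (hτ : HEq ((rho μ).map₂ τ) ((rho μ).map (cell μ s α x) ◁ β)) :
    ∃ βc : k ⟶ k', (rho μ).map₂ βc = β ∧ cell μ s α x ◁ βc = τ := by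
  obtain ⟨Q, rfl⟩ := Quotient.exists_rep β
  obtain ⟨T, rfl⟩ := Quotient.exists_rep τ
  let c := cell μ s α x
  have e := Trans.map_heq (rhoMap_comp c k)
  have e' := Trans.map_heq (rhoMap_comp c k')
  -- `Θ : T.p ≅ Q.p ⊕ s` expresses that `τ` lies over the whiskering of `β`.
  obtain ⟨Θ, h⟩ := Trans.exists_iso_of_mk_heq (s := M.tensor.obj k.s s)
    (t := M.tensor.obj k'.s s) (m := (rhoMap (c ≫ k)).map) (m' := (rhoMap c ≫ rhoMap k).map)
    (n := (rhoMap (c ≫ k')).map) (n' := (rhoMap c ≫ rhoMap k').map) (eq_of_heq e) (eq_of_heq e')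
    (P := rhoPre T) (Q := Q.whiskerLeft (rhoMap c)) hτ
  -- Transport along `Θ` makes the `X`-component of `T` end with the action of `Q.p ⊕ s` on `x`. By
  -- associativity this is the action of `Q.p` on `sx`, as a 2-cell `k ⟶ k'` with 1-cell `Q.p`
  -- requires.
  obtain ⟨G, hG⟩ := exists_heq₂ (μ.assoc.obj_eq _ _ _) rfl (cell_comp_map_snd_heq α x k)
    (g' := μ.act.mapL Q.p (μ.act.obj s x) ≫ k'.map.2)
    (comp_heq (μ.assoc.obj_eq _ _ _) (μ.assoc.obj_eq _ _ _) rfl (μ.assoc.map₁ _ _ _)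
      (cell_comp_map_snd_heq α x k'))
    (T.cell.2 ≫ μ.act.mapL₂ Θ.hom x ▷ (c ≫ k').map.2)
  let R : Trans.PreHom₂ k k' := ⟨Q.p, (Q.cell.1, G)⟩
  have t {ν : M.Action X} {x y z : SInv ν} (f : x ⟶ y) {g h : y ⟶ z} (Q : Trans.PreHom₂ g h) :
      HEq ((M.selfAction.prod ν).act.mapL (Q.whiskerLeft f).p x.pt ≫ (f ≫ h).map)
        ((M.selfAction.prod ν).act.mapL Q.p _ ≫
          ((M.selfAction.prod ν).act.mapR h.s f.map ≫ h.map)) :=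
    comp_heq (obj_eq _ _ _) (obj_eq _ _ _) rfl ((M.selfAction.prod ν).assoc.map₁ _ _ _)
      (Trans.comp_map_heq f h)
  have t' {x y z : SInv M.trivialAction} (f : x ⟶ y) {g h : y ⟶ z} (Q : Trans.PreHom₂ g h) :
      HEq ((M.selfAction.prod M.trivialAction).act.mapL (Q.whiskerLeft f).p x.pt ≫ (f ≫ h).map)
        ((M.selfAction.prod M.trivialAction).act.mapL Q.p _ ≫
          ((M.selfAction.prod M.trivialAction).act.mapR h.s f.map ≫ h.map)) :=
    comp_heq (obj_eq _ _ _) (obj_eq _ _ _) rfl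
      ((M.selfAction.prod M.trivialAction).assoc.map₁ _ _ _) (Trans.comp_map_heq f h)
  refine ⟨Quotient.mk (Trans.PreHom₂.setoid k k') R, ?_, ?_⟩
  · exact mk_ext (Iso.refl Q.p) (((congrArg (fun θ => Q.cell.1 ≫ θ ▷ k'.map.1)
      (M.tensor.mapL₂_id _ _)).trans (congrArg (Q.cell.1 ≫ ·) (id_whiskerRight _ _))).trans
      (Category.comp_id _))
  -- The same `Θ` identifies `T` with the whiskering of `R`: on `S`-components by `h`, on
  -- `X`-components by the choice of `G`.
  · refine (Quotient.sound (s := Trans.PreHom₂.setoid _ _) (a := T) (b := R.whiskerLeft c)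
      ⟨Θ, Prod.ext (eq_of_heq ?_) (eq_of_heq ?_)⟩).symm
    · refine (fst_heq₂ rfl rfl e (comp_heq rfl rfl rfl HEq.rfl e') h).trans ?_
      exact (fst_heq₂ (obj_eq _ _ _) rfl (Trans.comp_map_heq (rhoMap c) (rhoMap k))
        (t' (rhoMap c) Q) (Trans.PreHom₂.whiskerLeft_cell_heq (rhoMap c) Q)).trans
        (fst_heq₂ (obj_eq _ _ _) rfl (Trans.comp_map_heq c k) (t c R)
          (Trans.PreHom₂.whiskerLeft_cell_heq c R)).symm
    · exact hG.symm.trans (cell_whiskerLeft_snd_heq α x R).symm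

theorem isOpcartesian_cell
    (hM : ∀ {s t : S} {f g : s ⟶ t} {η θ : f ⟶ g} (a : S),
      M.tensor.mapL₂ η a = M.tensor.mapL₂ θ a → η = θ)
    (hS₁ : ∀ {a b : S} (f : a ⟶ b), IsInvertible₁ f)
    (hS₂ : ∀ {a b : S} {f g : a ⟶ b} (η : f ⟶ g), IsIso η)
    (hiso : ∀ {y z : SInv μ} {f g : y ⟶ z} (η : f ⟶ g), IsIso η)
    {s a d : S} (α : M.tensor.obj s a ⟶ d) (x : X) :
    IsOpcartesian (rho μ) (cell μ s α x) := by
  refine isOpcartesian_of_unique_lift _ (exists_lift_cell hiso α x) fun {z k k'} β τ h => ?_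
  have hτ : HEq ((rho μ).map₂ τ) ((rho μ).map (cell μ s α x) ◁ β) :=
    (rho_mapComp_inv_comp_heq (cell μ s α x) k _).symm.trans
      ((heq_of_eq h).trans (rho_comp_mapComp_inv_heq (cell μ s α x) k' _))
  refine existsUnique_of_exists_of_unique (exists_cell_whiskerLeft_eq α x β τ hτ) ?_
  rintro ⟨P⟩ ⟨Q⟩ ⟨h₁, h₂⟩ ⟨h₃, h₄⟩
  -- Both fillers lie over `β`, so some `Θ` matches their `S`-data. Moving `P` along `Θ` gives a
  -- representative of the same class with the 1-cell and `S`-component of `Q`.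
  obtain ⟨Θ, hΘ⟩ := Quotient.exact (h₁.trans h₃.symm)
  have hP : (Quotient.mk (Trans.PreHom₂.setoid k k') P) = Quotient.mk _ ⟨Q.p, P.cell ≫
      (M.selfAction.prod μ).act.mapL₂ Θ.hom (d, μ.act.obj s x) ▷ k'.map⟩ :=
    Quotient.sound ⟨Θ, rfl⟩
  refine hP.trans (congrArg (fun C => Quotient.mk _ (Trans.PreHom₂.mk Q.p C))
    (mk_eq_of_cell_whiskerLeft_eq hM hS₁ hS₂ α x Q.p ?_ ?_))
  · exact congrArg (fun c => c.1) hΘ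
  · exact (congrArg (cell μ s α x ◁ ·) hP).symm.trans (h₂.trans h₄.symm)

end SInv

end Projection

end GrayAct
/-- For a permutative Gray monoid `S` with faithful translations and invertible 1- and 2-cells,
acting on a 2-category `X` with invertible 2-cells, the projection `ρ : S⁻¹X ⟶ S⁻¹*` is an
opfibration; the 1-cells `(s, α, 1)` are opcartesian and all 2-cells are cartesian. -/
theorem mainTheorem5 {S : Type u₁} [Bicategory.{w₁, v₁} S] [Bicategory.Strict S]
    (M : GrayAct.PermutativeGrayMonoid S)
    {X : Type u₂} [Bicategory.{w₂, v₂} X] [Bicategory.Strict X]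
    (μ : M.toGrayMonoid.Action X)
    (hS : M.toGrayMonoid.FaithfulTranslations)
    (hS₁ : ∀ {a b : S} (f : a ⟶ b), GrayAct.IsInvertible₁ f)
    (hS₂ : ∀ {a b : S} {f g : a ⟶ b} (η : f ⟶ g), IsIso η)
    (hX : ∀ {x y : X} {f g : x ⟶ y} (η : f ⟶ g), IsIso η) :
    GrayAct.IsOpfibration (GrayAct.rho μ) ∧
      (∀ (s a d : S) (α : M.tensor.obj s a ⟶ d) (x : X),
        GrayAct.IsOpcartesian (GrayAct.rho μ) (GrayAct.SInv.cell μ s α x)) ∧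
      (∀ {y z : GrayAct.SInv μ} {f g : y ⟶ z} (η : f ⟶ g),
        GrayAct.IsCartesian₂ (GrayAct.rho μ) η) := by
  have hiso {y z : GrayAct.SInv μ} {f g : y ⟶ z} (η : f ⟶ g) : IsIso η :=
    GrayAct.Trans.isIso₂ hS₁ (GrayAct.isIso_prod₂ hS₂ hX) η
  have hcart {y z : GrayAct.SInv μ} {f g : y ⟶ z} (η : f ⟶ g) :
      GrayAct.IsCartesian₂ (GrayAct.rho μ) η :=
    have := hiso η
    GrayAct.isCartesian₂_of_isIso _ η
  have hop (s a d : S) (α : M.tensor.obj s a ⟶ d) (x : X) :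
      GrayAct.IsOpcartesian (GrayAct.rho μ) (GrayAct.SInv.cell μ s α x) :=
    GrayAct.SInv.isOpcartesian_cell (M.mapL₂_injective hS hS₁) hS₁ hS₂ hiso α x
  refine ⟨⟨?_, GrayAct.SInv.isLocalFibration hiso, fun _ _ _ _ => hcart _⟩, hop, hcart⟩
  -- A 1-cell of `S⁻¹*` out of `(a, *)` is just a pair `(s, α)`, its other component being forced.
  -- So `(s, α, 1)`, with target `(d, sx)`, lies strictly over it.
  rintro ⟨a, x⟩ ⟨d, c⟩ ⟨s, α, γ⟩
  obtain rfl : c = GrayAct.Pt.star := Subsingleton.elim _ _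
  obtain rfl : γ = 𝟙 GrayAct.Pt.star := Subsingleton.elim _ _
  exact ⟨_, GrayAct.SInv.cell μ s α x, rfl, HEq.rfl, hop s a d α x⟩
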